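/- Let $n\ge 1$, let $\mathbb B^n$ be the open unit ball of $\mathbb R^n$ and $S^{n-1}$ the unit sphere. For $x\in\mathbb B^n$ and $y\in\mathbb B^n$ put $$T_x(y)=\frac{(1+2x\cdot y+|y|^2)\,x+(1-|x|^2)\,y}{1+2x\cdot y+|x|^2|y|^2}$$ (a Möbius self-map of the ball with inverse $T_{-x}$). For $p\in S^{n-1}$ and $t\in(-1,1)$ let $H_p=\{y\in\mathbb B^n: y\cdot p\le 0\}$, $H(p,t)=T_{pt}(H_p)$, $R_p(y)=y-2(y\cdot p)p$, $R_{p,t}=T_{pt}\circ R_p\circ (T_{pt})^{-1}$, and let the fold map $F=F_{p,t}:\mathbb B^n\to H(p,t)$ be $F(y)=y$ if $y\in H(p,t)$ and $F(y)=R_{p,t}(y)$ if $y\in\mathbb B^n\setminus H(p,t)$. Let $g:[0,1)\to\mathbb R$ be continuous with $g(0)=0$ and $\int_0^1 g(r)(1-r^2)^{-1}\,dr=\infty$, meaning $\int_0^\rho g(r)(1-r^2)^{-1}\,dr\to\infty$ as $\rho\to1^-$. Let $v(y)=g(|y|)\,y/|y|$ for $y\in\mathbb B^n\setminus\{0\}$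 and $v(0)=0$. Let $\Omega$ be a measurable set whose closure is contained in $\mathbb B^n$, and let $f$ be nonnegative on $\Omega$ with $0<\int_\Omega f(y)(1-|y|^2)^{-n}\,dy<\infty$. Then for all $p\in S^{n-1}$ and $t\in(-1,1)$ the integral below converges absolutely for every $x\in\mathbb B^n$, and there is a point $x\in\mathbb B^n$ with $$\int_\Omega v\big(T_x(F_{p,t}(y))\big)\,f(y)\,(1-|y|^2)^{-n}\,dy=0 .$$ Suppose in addition that $g$ is increasing (not necessarily strictly) with $g(r)>0$ for $0<r<1$, and that $n\ge2$ or $g$ is strictly increasing. Then for each $(p,t)$ the point $x=x(p,t)$ is unique, and $x(p,t)$ is a continuous function of $(p,t)\in S^{n-1}\times(-1,1)$. -/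

import Mathlib

open Set Filter Topology MeasureTheory

namespace HypFold

/-- The point space `ℝⁿ` with its Euclidean norm; the open unit ball is `Metric.ball 0 1`. -/
abbrev Pt (n : ℕ) : Type := EuclideanSpace ℝ (Fin n)

/-- The Möbius map `T_x` of the ball:
`T_x(y) = ((1 + 2 x·y + |y|²) x + (1 - |x|²) y) / (1 + 2 x·y + |x|²|y|²)`. -/
noncomputable def mobius {n : ℕ} (x y : Pt n) : Pt n :=
  (1 + 2 * inner ℝ x y + ‖x‖ ^ 2 * ‖y‖ ^ 2)⁻¹ •
    ((1 + 2 * inner ℝ x y + ‖y‖ ^ 2) • x + (1 - ‖x‖ ^ 2) • y)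

theorem mobius_denom_pos {n : ℕ} {x y : Pt n}
    (hx : x ∈ Metric.ball (0 : Pt n) 1) (hy : y ∈ Metric.ball (0 : Pt n) 1) :
    0 < 1 + 2 * inner ℝ x y + ‖x‖ ^ 2 * ‖y‖ ^ 2 := by
  rw [mem_ball_zero_iff] at hx hy
  have h := (abs_le.mp (abs_real_inner_le_norm x y)).1
  have h1 : ‖x‖ * ‖y‖ < 1 := by
    nlinarith [norm_nonneg x, norm_nonneg y]
  nlinarith [sq_pos_of_pos (sub_pos.mpr h1)]

theorem norm_sq_mobius {n : ℕ} {x y : Pt n}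
    (hx : x ∈ Metric.ball (0 : Pt n) 1) (hy : y ∈ Metric.ball (0 : Pt n) 1) :
    ‖mobius x y‖ ^ 2 = (‖x‖ ^ 2 + 2 * inner ℝ x y + ‖y‖ ^ 2) /
      (1 + 2 * inner ℝ x y + ‖x‖ ^ 2 * ‖y‖ ^ 2) := by
  have hD := mobius_denom_pos hx hy
  rw [mobius, norm_smul, mul_pow, norm_add_sq_real, norm_smul, norm_smul, inner_smul_left,
    inner_smul_right, mul_pow, mul_pow]
  simp only [Real.norm_eq_abs, sq_abs, conj_trivial]
  field_simp
  ring

theorem mobius_mem_ball {n : ℕ} {x y : Pt n}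
    (hx : x ∈ Metric.ball (0 : Pt n) 1) (hy : y ∈ Metric.ball (0 : Pt n) 1) :
    mobius x y ∈ Metric.ball (0 : Pt n) 1 := by
  have hD := mobius_denom_pos hx hy
  have h := norm_sq_mobius hx hy
  rw [mem_ball_zero_iff] at hx hy ⊢
  have h1 : ‖mobius x y‖ ^ 2 < 1 := by
    rw [h, div_lt_one hD]
    have hx2 : 0 < 1 - ‖x‖ ^ 2 := by nlinarith [norm_nonneg x]
    have hy2 : 0 < 1 - ‖y‖ ^ 2 := by nlinarith [norm_nonneg y]
    nlinarith [mul_pos hx2 hy2]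
  nlinarith [norm_nonneg (mobius x y)]

/-- `T_{-x}` is the inverse of `T_x` on the ball. -/
theorem mobius_neg_mobius {n : ℕ} {x y : Pt n}
    (hx : x ∈ Metric.ball (0 : Pt n) 1) (hy : y ∈ Metric.ball (0 : Pt n) 1) :
    mobius (-x) (mobius x y) = y := by
  have hD := mobius_denom_pos hx hy
  have h := norm_sq_mobius hx hy
  have hm : mobius x y = (1 + 2 * inner ℝ x y + ‖x‖ ^ 2 * ‖y‖ ^ 2)⁻¹ •
    ((1 + 2 * inner ℝ x y + ‖y‖ ^ 2) • x + (1 - ‖x‖ ^ 2) • y) := rfl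
  set D := 1 + 2 * inner ℝ x y + ‖x‖ ^ 2 * ‖y‖ ^ 2 with hDdef
  have hx2 : 0 < 1 - ‖x‖ ^ 2 := by
    rw [mem_ball_zero_iff] at hx
    nlinarith [norm_nonneg x]
  have hi : inner ℝ (-x) (mobius x y) =
      -((1 + 2 * inner ℝ x y + ‖y‖ ^ 2) * ‖x‖ ^ 2 + (1 - ‖x‖ ^ 2) * inner ℝ x y) /
        D := by
    rw [hm, inner_neg_left, inner_smul_right, inner_add_right, inner_smul_right,
      inner_smul_right, real_inner_self_eq_norm_sq]
    field_simp
  have hd : 1 + 2 * inner ℝ (-x) (mobius x y) + ‖-x‖ ^ 2 * ‖mobius x y‖ ^ 2 =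
      (1 - ‖x‖ ^ 2) ^ 2 / D := by
    rw [hi, h, norm_neg]
    field_simp
    rw [hDdef]
    ring
  have hn : 1 + 2 * inner ℝ (-x) (mobius x y) + ‖mobius x y‖ ^ 2 =
      (1 - ‖x‖ ^ 2) * (1 + 2 * inner ℝ x y + ‖y‖ ^ 2) /
        D := by
    rw [hi, h]
    field_simp
    rw [hDdef]
    ring
  rw [mobius, hd, hn, norm_neg, hm]
  match_scalars <;> field_simp
  ring

/-- The closed halfball `H_p = {y ∈ 𝔹ⁿ : y·p ≤ 0}` with normal vector `p`. -/
def halfBallAtZero {n : ℕ} (p : Pt n) : Set (Pt n) :=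
  {y | y ∈ Metric.ball (0 : Pt n) 1 ∧ inner ℝ y p ≤ 0}

/-- The hyperbolic halfball `H(p,t) = T_{pt}(H_p)`. -/
def halfBall {n : ℕ} (p : Pt n) (t : ℝ) : Set (Pt n) :=
  mobius (t • p) '' halfBallAtZero p

/-- The Euclidean reflection `R_p(y) = y - 2 (y·p) p`. -/
noncomputable def reflectAtZero {n : ℕ} (p y : Pt n) : Pt n :=
  y - (2 * inner ℝ y p) • p

/-- The hyperbolic reflection `R_{p,t} = T_{pt} ∘ R_p ∘ (T_{pt})⁻¹`, where `(T_{pt})⁻¹ = T_{-pt}`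
by `mobius_neg_mobius`. -/
noncomputable def hypReflect {n : ℕ} (p : Pt n) (t : ℝ) (y : Pt n) : Pt n :=
  mobius (t • p) (reflectAtZero p (mobius (-(t • p)) y))

open Classical in
/-- The fold map onto `H(p,t)`: the identity on `H(p,t)`, and the hyperbolic reflection
across its boundary on the rest of the ball. -/
noncomputable def fold {n : ℕ} (p : Pt n) (t : ℝ) (y : Pt n) : Pt n :=
  if y ∈ halfBall p t then y else hypReflect p t y

/-- The radial vector field with magnitude `g`: `v(y) = g(|y|) y/|y|` for `y ≠ 0`, and
`v(0) = 0`. -/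
noncomputable def radialField {n : ℕ} (g : ℝ → ℝ) (y : Pt n) : Pt n :=
  if y = 0 then 0 else g ‖y‖ • (‖y‖⁻¹ • y)

/-- The integrand `v(T_x(F(y))) f(y) (1 - |y|²)⁻ⁿ`, where `F` is the fold map onto `H(p,t)`. -/
noncomputable def foldIntegrand {n : ℕ} (g : ℝ → ℝ) (f : Pt n → ℝ) (p : Pt n) (t : ℝ)
    (x y : Pt n) : Pt n :=
  (f y * (1 - ‖y‖ ^ 2) ^ (-(n : ℤ))) • radialField g (mobius x (fold p t y))

end HypFold

/-!
The argument is variational. With `ν` the measure `f(y) (1 - |y|²)⁻ⁿ dy` on `Ω`, `Z` the fold map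
and `G(ρ) = ∫₀^ρ g(r) (1 - r²)⁻¹ dr` the radial potential, consider the energy
`E(x) = ∫ G(|T_x(Z)|) dν` on the ball.

* Existence. The Euclidean gradient of `x ↦ G(|T_x(y)|)` is `(1 - |x|²)⁻¹ v(T_x(y))`
  (`hasFDerivAt_potential_mobius`), so the critical points of `E` are exactly the zeros of the
  average of `v` (`hasFDerivAt_energy`). As `G` tends to infinity at `1` and `Z` stays in a compact
  part of the ball, `E` tends to infinity at the sphere (`exists_le_energy`), hence it has an
  interior minimum.

* Uniqueness. If `g` is increasing and positive, `G(|T_x(y)|)` is convex along hyperbolic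
  geodesics. In the form used here, `G(|T_a(z)|) > G(|z|) + κ v(z)·a` with `κ = artanh |a| / |a|`,
  provided that `z` is off the line `ℝa` or `g` is strictly increasing
  (`potential_add_inner_lt`). This follows from the hyperbolic law of cosines and the convexity of
  the exponential function. Since `|T_{T_b(a)}(y)| = |T_a(T_b(y))|`, the inequality can be used in
  the frame of any point `b`, and integrating it shows that a zero of the average of `v` is the
  strict global minimum of `E` (`energy_lt_energy`). For `n ≥ 2` the points which the fold maps to
  a given geodesic form a null set (`ae_mobius_fold_notMem_span`), so weak monotonicity of `g`
  suffices.

* Continuity. On the ball the fold is `T_{pt} ∘ (w ↦ w - 2 max(0, w·p) p) ∘ T_{-pt}`, which is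
  jointly continuous in `(p, t, y)` (`continuousOn_fold`). Hence `E` is jointly continuous in `x`
  and `(p, t)`, the minimum points stay locally in a compact part of the ball, and every cluster
  point of them minimizes the limiting energy (`continuousWithinAt_of_energy_lt`).
-/

namespace HypFold

/-! ### Identities for the Möbius maps -/

theorem mobius_mobius_neg {n : ℕ} {x y : Pt n}
    (hx : x ∈ Metric.ball (0 : Pt n) 1) (hy : y ∈ Metric.ball (0 : Pt n) 1) :
    mobius x (mobius (-x) y) = y := by
  have h := mobius_neg_mobius (x := -x) (y := y) (by simpa using hx) hy
  rwa [neg_neg] at h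

theorem one_sub_norm_sq_pos {n : ℕ} {x : Pt n} (hx : x ∈ Metric.ball (0 : Pt n) 1) :
    0 < 1 - ‖x‖ ^ 2 := by
  rw [mem_ball_zero_iff] at hx
  nlinarith [norm_nonneg x]

theorem one_sub_norm_sq_mobius {n : ℕ} {x y : Pt n}
    (hx : x ∈ Metric.ball (0 : Pt n) 1) (hy : y ∈ Metric.ball (0 : Pt n) 1) :
    1 - ‖mobius x y‖ ^ 2 = (1 - ‖x‖ ^ 2) * (1 - ‖y‖ ^ 2) /
      (1 + 2 * inner ℝ x y + ‖x‖ ^ 2 * ‖y‖ ^ 2) := by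
  have hD := mobius_denom_pos hx hy
  rw [norm_sq_mobius hx hy]
  field_simp
  ring

theorem inner_mobius_left {n : ℕ} (x y z : Pt n) :
    inner ℝ (mobius x y) z = (1 + 2 * inner ℝ x y + ‖x‖ ^ 2 * ‖y‖ ^ 2)⁻¹ *
      ((1 + 2 * inner ℝ x y + ‖y‖ ^ 2) * inner ℝ x z + (1 - ‖x‖ ^ 2) * inner ℝ y z) := by
  simp [mobius, inner_smul_left, inner_add_left, mul_add]

/-- The maps `T_{T_b(a)}` and `T_a ∘ T_b` differ by a rotation, so the images of a point under
them have the same norm. -/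
theorem norm_mobius_mobius {n : ℕ} {a b y : Pt n}
    (ha : a ∈ Metric.ball (0 : Pt n) 1) (hb : b ∈ Metric.ball (0 : Pt n) 1)
    (hy : y ∈ Metric.ball (0 : Pt n) 1) :
    ‖mobius (mobius b a) y‖ = ‖mobius a (mobius b y)‖ := by
  have hba := mobius_mem_ball hb ha
  have hby := mobius_mem_ball hb hy
  have h1 := one_sub_norm_sq_mobius hba hy
  have h2 := one_sub_norm_sq_mobius ha hby
  have D1 := mobius_denom_pos hb ha
  have D2 := mobius_denom_pos hb hy
  have D3 := mobius_denom_pos hba hy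
  have D4 := mobius_denom_pos ha hby
  -- expanded, the left side is symmetric in `a` and `y`
  have key : (1 + 2 * inner ℝ b a + ‖b‖ ^ 2 * ‖a‖ ^ 2) *
      (1 + 2 * inner ℝ (mobius b a) y + ‖mobius b a‖ ^ 2 * ‖y‖ ^ 2) =
      (1 + 2 * inner ℝ b y + ‖b‖ ^ 2 * ‖y‖ ^ 2) *
      (1 + 2 * inner ℝ a (mobius b y) + ‖a‖ ^ 2 * ‖mobius b y‖ ^ 2) := by
    rw [real_inner_comm (mobius b y) a, inner_mobius_left, inner_mobius_left,
      norm_sq_mobius hb ha, norm_sq_mobius hb hy, real_inner_comm a y]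
    field_simp
    ring
  have h3 : 1 - ‖mobius (mobius b a) y‖ ^ 2 = 1 - ‖mobius a (mobius b y)‖ ^ 2 := by
    rw [h1, h2, one_sub_norm_sq_mobius hb ha, one_sub_norm_sq_mobius hb hy, ← mul_div_assoc,
      div_mul_eq_mul_div, div_div, div_div, key]
    congr 1
    ring
  exact (sq_eq_sq₀ (norm_nonneg _) (norm_nonneg _)).1 (by linarith)

theorem one_sub_norm_sq_mobius_ge {n : ℕ} {x y : Pt n}
    (hx : x ∈ Metric.ball (0 : Pt n) 1) (hy : y ∈ Metric.ball (0 : Pt n) 1) :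
    (1 - ‖x‖ ^ 2) * (1 - ‖y‖ ^ 2) / 4 ≤ 1 - ‖mobius x y‖ ^ 2 := by
  have hD := mobius_denom_pos hx hy
  have hx2 := one_sub_norm_sq_pos hx
  have hy2 := one_sub_norm_sq_pos hy
  rw [one_sub_norm_sq_mobius hx hy]
  have := real_inner_le_norm x y
  rw [mem_ball_zero_iff] at hx hy
  have hm : ‖x‖ * ‖y‖ ≤ 1 := by nlinarith [norm_nonneg x, norm_nonneg y]
  apply div_le_div_of_nonneg_left (by positivity) hD
  nlinarith [mul_nonneg (norm_nonneg x) (norm_nonneg y)]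

theorem one_sub_norm_sq_mobius_le {n : ℕ} {x y : Pt n}
    (hx : x ∈ Metric.ball (0 : Pt n) 1) (hy : y ∈ Metric.ball (0 : Pt n) 1) :
    1 - ‖mobius x y‖ ^ 2 ≤ (1 - ‖x‖ ^ 2) / (1 - ‖y‖) ^ 2 := by
  have hD := mobius_denom_pos hx hy
  have hx2 := one_sub_norm_sq_pos hx
  have hy2 := one_sub_norm_sq_pos hy
  rw [one_sub_norm_sq_mobius hx hy]
  have h := (abs_le.mp (abs_real_inner_le_norm x y)).1
  rw [mem_ball_zero_iff] at hx hy
  have hy1 : 0 < 1 - ‖y‖ := by linarith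
  have h1 : 1 - ‖y‖ ≤ 1 - ‖x‖ * ‖y‖ := by nlinarith [norm_nonneg x, norm_nonneg y]
  apply div_le_div₀ hx2.le _ (by positivity) (by nlinarith)
  nlinarith [sq_nonneg ‖y‖]

theorem continuousOn_mobius {n : ℕ} :
    ContinuousOn (fun q : Pt n × Pt n => mobius q.1 q.2)
      (Metric.ball (0 : Pt n) 1 ×ˢ Metric.ball (0 : Pt n) 1) := by
  have h : ContinuousOn (fun q : Pt n × Pt n =>
      (1 + 2 * inner ℝ q.1 q.2 + ‖q.1‖ ^ 2 * ‖q.2‖ ^ 2 : ℝ)⁻¹)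
      (Metric.ball (0 : Pt n) 1 ×ˢ Metric.ball (0 : Pt n) 1) :=
    ContinuousOn.inv₀ (by fun_prop) fun q hq => (mobius_denom_pos hq.1 hq.2).ne'
  have h' : Continuous (fun q : Pt n × Pt n =>
      (1 + 2 * inner ℝ q.1 q.2 + ‖q.2‖ ^ 2 : ℝ) • q.1 + (1 - ‖q.1‖ ^ 2) • q.2) := by
    fun_prop
  exact h.smul h'.continuousOn

theorem differentiableAt_mobius_left {n : ℕ} {x y : Pt n}
    (hx : x ∈ Metric.ball (0 : Pt n) 1) (hy : y ∈ Metric.ball (0 : Pt n) 1) :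
    DifferentiableAt ℝ (fun x => mobius x y) x := by
  have h := (mobius_denom_pos hx hy).ne'
  have h1 : DifferentiableAt ℝ (fun x : Pt n => ‖x‖ ^ 2) x :=
    differentiableAt_id.norm_sq ℝ
  have h2 : DifferentiableAt ℝ (fun x : Pt n => (inner ℝ x y : ℝ)) x :=
    differentiableAt_id.inner ℝ (differentiableAt_const y)
  unfold mobius
  exact DifferentiableAt.fun_smul (DifferentiableAt.fun_inv (by fun_prop) h) (by fun_prop)

theorem differentiableAt_mobius_right {n : ℕ} {x y : Pt n}
    (hx : x ∈ Metric.ball (0 : Pt n) 1) (hy : y ∈ Metric.ball (0 : Pt n) 1) :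
    DifferentiableAt ℝ (fun y => mobius x y) y := by
  have h := (mobius_denom_pos hx hy).ne'
  have h1 : DifferentiableAt ℝ (fun x : Pt n => ‖x‖ ^ 2) y :=
    differentiableAt_id.norm_sq ℝ
  have h2 : DifferentiableAt ℝ (fun y : Pt n => (inner ℝ x y : ℝ)) y :=
    (differentiableAt_const x).inner ℝ differentiableAt_id
  unfold mobius
  exact DifferentiableAt.fun_smul (DifferentiableAt.fun_inv (by fun_prop) h) (by fun_prop)

/-! ### The radial potential and its gradient -/

/-- The radial potential `G(ρ) = ∫₀^ρ g(r) (1 - r²)⁻¹ dr` of the field with magnitude `g`. The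
function `g` is extended evenly to `(-1, 1)`, so that `G` is differentiable at `0` as well. -/
noncomputable def potential (g : ℝ → ℝ) (ρ : ℝ) : ℝ :=
  ∫ r in (0 : ℝ)..ρ, g |r| * (1 - r ^ 2)⁻¹

theorem hasDerivAt_potential {g : ℝ → ℝ} (hg : ContinuousOn g (Ico 0 1)) {ρ : ℝ}
    (hρ : ρ ∈ Ioo (-1 : ℝ) 1) :
    HasDerivAt (potential g) (g |ρ| * (1 - ρ ^ 2)⁻¹) ρ := by
  have hc : ContinuousOn (fun r : ℝ => g |r| * (1 - r ^ 2)⁻¹) (Ioo (-1) 1) := by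
    refine ContinuousOn.mul (hg.comp continuous_abs.continuousOn ?_)
      (ContinuousOn.inv₀ (by fun_prop) ?_)
    · intro r hr
      exact ⟨abs_nonneg r, abs_lt.2 hr⟩
    · intro r hr
      have := (sq_lt_one_iff_abs_lt_one r).2 (abs_lt.2 hr)
      linarith
  refine intervalIntegral.integral_hasDerivAt_right ?_
    (hc.stronglyMeasurableAtFilter isOpen_Ioo _ hρ) (hc.continuousAt (isOpen_Ioo.mem_nhds hρ))
  exact (hc.mono (ordConnected_Ioo.uIcc_subset (by simp) hρ)).intervalIntegrable

theorem potential_zero (g : ℝ → ℝ) : potential g 0 = 0 := by simp [potential]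

theorem continuousOn_potential {g : ℝ → ℝ} (hg : ContinuousOn g (Ico 0 1)) :
    ContinuousOn (potential g) (Ioo (-1) 1) :=
  fun _ hρ => (hasDerivAt_potential hg hρ).continuousAt.continuousWithinAt

theorem tendsto_potential {g : ℝ → ℝ}
    (hgInt : Tendsto (fun ρ : ℝ => ∫ r in (0 : ℝ)..ρ, g r * (1 - r ^ 2)⁻¹) (𝓝[<] 1) atTop) :
    Tendsto (potential g) (𝓝[<] 1) atTop := by
  refine hgInt.congr' ?_
  filter_upwards [Ioo_mem_nhdsLT (zero_lt_one' ℝ)] with ρ hρ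
  refine intervalIntegral.integral_congr fun r hr => ?_
  rw [uIcc_of_le hρ.1.le] at hr
  simp only [abs_of_nonneg hr.1]

theorem norm_mem_Ioo {n : ℕ} {x : Pt n} (hx : x ∈ Metric.ball (0 : Pt n) 1) :
    ‖x‖ ∈ Ioo (-1 : ℝ) 1 :=
  ⟨by linarith [norm_nonneg x], by simpa using hx⟩

theorem norm_radialField {n : ℕ} {g : ℝ → ℝ} (hg0 : g 0 = 0) (y : Pt n) :
    ‖radialField g y‖ = |g ‖y‖| := by
  unfold radialField
  split_ifs with h
  · simp [h, hg0]
  · rw [norm_smul, norm_smul, norm_inv, norm_norm, inv_mul_cancel₀ (norm_ne_zero_iff.2 h)]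
    simp

theorem continuousOn_radialField {n : ℕ} {g : ℝ → ℝ} (hg : ContinuousOn g (Ico 0 1))
    (hg0 : g 0 = 0) : ContinuousOn (radialField g) (Metric.ball (0 : Pt n) 1) := by
  intro y hy
  have hgc : ContinuousOn (fun y : Pt n => g ‖y‖) (Metric.ball (0 : Pt n) 1) :=
    hg.comp continuous_norm.continuousOn fun y hy => ⟨norm_nonneg y, (norm_mem_Ioo hy).2⟩
  by_cases h : y = 0
  · subst h
    have h0 : radialField g (0 : Pt n) = 0 := by simp [radialField]
    rw [ContinuousWithinAt, h0, tendsto_zero_iff_norm_tendsto_zero]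
    simp only [norm_radialField hg0]
    have := (hgc 0 hy).abs
    simpa [ContinuousWithinAt, hg0] using this
  · have h1 : ContinuousWithinAt (fun y : Pt n => g ‖y‖ • (‖y‖⁻¹ • y))
        (Metric.ball (0 : Pt n) 1) y :=
      (hgc y hy).smul ((continuous_norm.continuousWithinAt.inv₀ (norm_ne_zero_iff.2 h)).smul
        continuousWithinAt_id)
    refine h1.congr_of_eventuallyEq ?_ (by simp [radialField, h])
    filter_upwards [mem_nhdsWithin_of_mem_nhds (isOpen_ne.mem_nhds h)] with w hw
    exact if_neg hw

/-- The Euclidean gradient of `x ↦ |T_x(y)|²` is `2 (1 - |T_x(y)|²) (1 - |x|²)⁻¹ T_x(y)`. -/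
theorem hasFDerivAt_norm_sq_mobius {n : ℕ} {x y : Pt n}
    (hx : x ∈ Metric.ball (0 : Pt n) 1) (hy : y ∈ Metric.ball (0 : Pt n) 1) :
    HasFDerivAt (fun x => ‖mobius x y‖ ^ 2)
      (innerSL ℝ ((2 * (1 - ‖mobius x y‖ ^ 2) * (1 - ‖x‖ ^ 2)⁻¹) • mobius x y)) x := by
  have hD := mobius_denom_pos hx hy
  have hx2 := one_sub_norm_sq_pos hx
  have hsq : HasFDerivAt (fun x : Pt n => ‖x‖ ^ 2) (2 • innerSL ℝ x) x :=
    (hasStrictFDerivAt_norm_sq x).hasFDerivAt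
  have hin : HasFDerivAt (fun x : Pt n => (inner ℝ y x : ℝ)) (innerSL ℝ y) x :=
    (innerSL ℝ y).hasFDerivAt
  have hden : HasFDerivAt (fun x : Pt n => 1 + 2 * inner ℝ y x + ‖x‖ ^ 2 * ‖y‖ ^ 2) _ x :=
    ((hin.const_mul 2).const_add 1).add (hsq.mul_const (‖y‖ ^ 2))
  rw [real_inner_comm] at hD
  have hinv := (hasDerivAt_inv hD.ne').comp_hasFDerivAt x hden
  have hN := (((hsq.const_sub 1).mul_const (1 - ‖y‖ ^ 2)).mul hinv).const_sub 1
  refine (hN.congr_of_eventuallyEq ?_).congr_fderiv ?_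
  · filter_upwards [Metric.isOpen_ball.mem_nhds hx] with w hw
    have := one_sub_norm_sq_mobius hw hy
    rw [real_inner_comm, div_eq_mul_inv] at this
    simp only [Function.comp, Pi.mul_apply]
    linarith
  · ext v
    simp only [one_sub_norm_sq_mobius hx hy]
    rw [map_smul]
    simp only [smul_apply, innerSL_apply_apply, inner_mobius_left,
      neg_apply, add_apply,
      smul_eq_mul, nsmul_eq_mul, Function.comp]
    rw [real_inner_comm y x] at *
    field_simp
    push_cast
    ring

/-- The key gradient formula: `∇ₓ G(|T_x(y)|) = (1 - |x|²)⁻¹ v(T_x(y))`. -/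
theorem hasFDerivAt_potential_mobius {n : ℕ} {g : ℝ → ℝ} (hg : ContinuousOn g (Ico 0 1))
    (hg0 : g 0 = 0) {x y : Pt n}
    (hx : x ∈ Metric.ball (0 : Pt n) 1) (hy : y ∈ Metric.ball (0 : Pt n) 1) :
    HasFDerivAt (fun x => potential g ‖mobius x y‖)
      (innerSL ℝ ((1 - ‖x‖ ^ 2)⁻¹ • radialField g (mobius x y))) x := by
  have hm := mobius_mem_ball hx hy
  have hm2 := one_sub_norm_sq_pos hm
  have hG := hasDerivAt_potential hg (norm_mem_Ioo hm)
  by_cases h : mobius x y = 0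
  · -- the norm is not differentiable here, but `G` vanishes to first order because `g(0) = 0`
    have h1 : HasFDerivAt (fun w : Pt n => potential g ‖w‖) (0 : Pt n →L[ℝ] ℝ) (mobius x y) := by
      rw [h] at hG ⊢
      simp only [norm_zero, abs_zero, hg0, zero_mul] at hG
      have h2 := hasDerivAt_iff_isLittleO_nhds_zero.1 hG
      have h3 : (fun w : Pt n => potential g ‖w‖) =o[𝓝 0] fun w : Pt n => ‖w‖ := by
        simpa [Function.comp_def, potential_zero] using
          h2.comp_tendsto (tendsto_norm_zero (E := Pt n))
      refine .of_isLittleO ?_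
      simpa [potential_zero] using h3.of_norm_right
    have h4 := h1.comp x (differentiableAt_mobius_left hx hy).hasFDerivAt
    simpa [h, radialField, Function.comp_def] using h4
  · have h0 : ‖mobius x y‖ ≠ 0 := norm_ne_zero_iff.2 h
    have h1 := (hasFDerivAt_norm_sq_mobius hx hy).sqrt (by positivity)
    simp only [Real.sqrt_sq (norm_nonneg _)] at h1
    have h2 := hG.comp_hasFDerivAt x h1
    refine h2.congr_fderiv ?_
    have hx2 := one_sub_norm_sq_pos hx
    ext v
    rw [radialField, if_neg h, abs_of_nonneg (norm_nonneg _)]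
    simp only [map_smul, smul_apply, smul_eq_mul]
    field_simp

/-! ### Convexity of the potential along hyperbolic geodesics -/

theorem exp_mul_le_cosh_add_mul_sinh {c : ℝ} (hc : |c| ≤ 1) (s : ℝ) :
    Real.exp (c * s) ≤ Real.cosh s + c * Real.sinh s := by
  obtain ⟨h1, h2⟩ := abs_le.1 hc
  have h := convexOn_exp.2 (mem_univ s) (mem_univ (-s))
    (by linarith : 0 ≤ (1 + c) / 2) (by linarith : 0 ≤ (1 - c) / 2) (by ring)
  simp only [smul_eq_mul] at h
  rw [show (1 + c) / 2 * s + (1 - c) / 2 * -s = c * s by ring] at h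
  rw [Real.cosh_eq, Real.sinh_eq]
  linarith

theorem exp_mul_lt_cosh_add_mul_sinh {c : ℝ} (hc : |c| < 1) {s : ℝ} (hs : s ≠ 0) :
    Real.exp (c * s) < Real.cosh s + c * Real.sinh s := by
  obtain ⟨h1, h2⟩ := abs_lt.1 hc
  have h := strictConvexOn_exp.2 (mem_univ s) (mem_univ (-s)) (fun h => hs (by linarith))
    (by linarith : 0 < (1 + c) / 2) (by linarith : 0 < (1 - c) / 2) (by ring)
  simp only [smul_eq_mul] at h
  rw [show (1 + c) / 2 * s + (1 - c) / 2 * -s = c * s by ring] at h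
  rw [Real.cosh_eq, Real.sinh_eq]
  linarith

/-- Comparison with the hyperbolic law of cosines: the third side of a hyperbolic triangle with
sides `r`, `s` enclosing an angle of cosine `-c` is at least `|r + c s|`. -/
theorem cosh_add_mul_le {c : ℝ} (hc : |c| ≤ 1) (r s : ℝ) :
    Real.cosh (r + c * s) ≤ Real.cosh r * Real.cosh s + Real.sinh r * Real.sinh s * c := by
  have h1 := exp_mul_le_cosh_add_mul_sinh hc s
  have h2 := exp_mul_le_cosh_add_mul_sinh (c := -c) (by rwa [abs_neg]) s
  have e1 := mul_le_mul_of_nonneg_left h1 (Real.exp_pos r).le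
  have e2 := mul_le_mul_of_nonneg_left h2 (Real.exp_pos (-r)).le
  rw [← Real.exp_add] at e1 e2
  rw [Real.cosh_eq (r + c * s), Real.cosh_eq r, Real.sinh_eq r,
    show -(r + c * s) = -r + -c * s by ring]
  linarith

theorem cosh_add_mul_lt {c : ℝ} (hc : |c| < 1) (r : ℝ) {s : ℝ} (hs : s ≠ 0) :
    Real.cosh (r + c * s) < Real.cosh r * Real.cosh s + Real.sinh r * Real.sinh s * c := by
  have h1 := exp_mul_lt_cosh_add_mul_sinh hc hs
  have h2 := exp_mul_lt_cosh_add_mul_sinh (c := -c) (by rwa [abs_neg]) hs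
  have e1 := mul_lt_mul_of_pos_left h1 (Real.exp_pos r)
  have e2 := mul_lt_mul_of_pos_left h2 (Real.exp_pos (-r))
  rw [← Real.exp_add] at e1 e2
  rw [Real.cosh_eq (r + c * s), Real.cosh_eq r, Real.sinh_eq r,
    show -(r + c * s) = -r + -c * s by ring]
  linarith

theorem cosh_two_mul_artanh {ρ : ℝ} (hρ : ρ ∈ Ioo (-1 : ℝ) 1) :
    Real.cosh (2 * Real.artanh ρ) = (1 + ρ ^ 2) / (1 - ρ ^ 2) := by
  have h : 0 < 1 - ρ ^ 2 := by nlinarith [hρ.1, hρ.2]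
  rw [Real.cosh_two_mul, Real.cosh_artanh hρ, Real.sinh_artanh hρ, div_pow, div_pow,
    Real.sq_sqrt h.le]
  ring

theorem sinh_two_mul_artanh {ρ : ℝ} (hρ : ρ ∈ Ioo (-1 : ℝ) 1) :
    Real.sinh (2 * Real.artanh ρ) = 2 * ρ / (1 - ρ ^ 2) := by
  have h : 0 < 1 - ρ ^ 2 := by nlinarith [hρ.1, hρ.2]
  rw [Real.sinh_two_mul, Real.cosh_artanh hρ, Real.sinh_artanh hρ, mul_assoc,
    div_mul_div_comm, Real.mul_self_sqrt h.le]
  ring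

/-- The hyperbolic law of cosines for the triangle with vertices `0`, `-a`, `z`. -/
theorem cosh_two_mul_artanh_norm_mobius {n : ℕ} {a z : Pt n}
    (ha : a ∈ Metric.ball (0 : Pt n) 1) (hz : z ∈ Metric.ball (0 : Pt n) 1) {c : ℝ}
    (hc : inner ℝ a z = ‖a‖ * ‖z‖ * c) :
    Real.cosh (2 * Real.artanh ‖mobius a z‖) =
      Real.cosh (2 * Real.artanh ‖z‖) * Real.cosh (2 * Real.artanh ‖a‖) +
        Real.sinh (2 * Real.artanh ‖z‖) * Real.sinh (2 * Real.artanh ‖a‖) * c := by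
  have hm := mobius_mem_ball ha hz
  have hD := mobius_denom_pos ha hz
  have ha2 := one_sub_norm_sq_pos ha
  have hz2 := one_sub_norm_sq_pos hz
  rw [cosh_two_mul_artanh (norm_mem_Ioo hm), cosh_two_mul_artanh (norm_mem_Ioo ha),
    cosh_two_mul_artanh (norm_mem_Ioo hz), sinh_two_mul_artanh (norm_mem_Ioo ha),
    sinh_two_mul_artanh (norm_mem_Ioo hz), one_sub_norm_sq_mobius ha hz, norm_sq_mobius ha hz]
  have e : 1 + ‖a‖ ^ 2 * ‖z‖ ^ 2 + ‖a‖ ^ 2 + ‖z‖ ^ 2 + 4 * (‖a‖ * ‖z‖ * c) =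
      1 + 2 * inner ℝ a z + ‖a‖ ^ 2 * ‖z‖ ^ 2 + (‖a‖ ^ 2 + 2 * inner ℝ a z + ‖z‖ ^ 2) := by
    rw [hc]
    ring
  generalize 1 + 2 * inner ℝ a z + ‖a‖ ^ 2 * ‖z‖ ^ 2 = D at hD e ⊢
  field_simp
  linear_combination -e

theorem hasDerivAt_tanh (t : ℝ) : HasDerivAt Real.tanh (1 - Real.tanh t ^ 2) t := by
  have h := (Real.hasDerivAt_sinh t).div (Real.hasDerivAt_cosh t) (Real.cosh_pos t).ne'
  have h2 : Real.tanh = Real.sinh / Real.cosh := by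
    ext x
    exact Real.tanh_eq_sinh_div_cosh x
  rw [h2]
  refine h.congr_deriv ?_
  have := (Real.cosh_pos t).ne'
  simp only [Pi.div_apply]
  field_simp

/-- In the arc length coordinate `t = artanh ρ` the potential has derivative `g(tanh t)`. -/
theorem hasDerivAt_potential_tanh {g : ℝ → ℝ} (hg : ContinuousOn g (Ico 0 1)) (t : ℝ) :
    HasDerivAt (fun t => potential g (Real.tanh t)) (g |Real.tanh t|) t := by
  have h := (hasDerivAt_potential hg (abs_lt.1 (Real.abs_tanh_lt_one t))).comp t (hasDerivAt_tanh t)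
  refine h.congr_deriv ?_
  have := (sq_lt_one_iff_abs_lt_one _).2 (Real.abs_tanh_lt_one t)
  rw [mul_assoc, inv_mul_cancel₀ (by linarith), mul_one]

/-- The mean value theorem in the arc length coordinate `artanh ρ`. -/
theorem exists_potential_sub_eq {g : ℝ → ℝ} (hg : ContinuousOn g (Ico 0 1)) {ρ₀ ρ₁ : ℝ}
    (h0 : 0 ≤ ρ₀) (h01 : ρ₀ < ρ₁) (h1 : ρ₁ < 1) :
    ∃ ξ ∈ Ioo ρ₀ ρ₁,
      potential g ρ₁ - potential g ρ₀ = g ξ * (Real.artanh ρ₁ - Real.artanh ρ₀) := by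
  have m0 : ρ₀ ∈ Ioo (-1 : ℝ) 1 := ⟨by linarith, by linarith⟩
  have m1 : ρ₁ ∈ Ioo (-1 : ℝ) 1 := ⟨by linarith, by linarith⟩
  have hr := Real.artanh_lt_artanh m0.1 m1.2 h01
  obtain ⟨t, ht, h⟩ := exists_hasDerivAt_eq_slope (fun t => potential g (Real.tanh t))
    (fun t => g |Real.tanh t|) hr
    (fun t _ => (hasDerivAt_potential_tanh hg t).continuousAt.continuousWithinAt)
    (fun t _ => hasDerivAt_potential_tanh hg t)
  have mt : Real.tanh t ∈ Ioo (-1 : ℝ) 1 := abs_lt.1 (Real.abs_tanh_lt_one t)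
  have l0 : ρ₀ < Real.tanh t := by
    rw [← Real.artanh_lt_artanh_iff m0 mt, Real.artanh_tanh]
    exact ht.1
  have l1 : Real.tanh t < ρ₁ := by
    rw [← Real.artanh_lt_artanh_iff mt m1, Real.artanh_tanh]
    exact ht.2
  refine ⟨Real.tanh t, ⟨l0, l1⟩, ?_⟩
  simp only [Real.tanh_artanh m0, Real.tanh_artanh m1] at h
  rw [abs_of_pos (by linarith)] at h
  rw [h, div_mul_cancel₀ _ (by linarith)]

/-- The potential is convex in the coordinate `artanh ρ`: it lies above its tangents. -/
theorem potential_add_le {g : ℝ → ℝ} (hg : ContinuousOn g (Ico 0 1))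
    (hmono : MonotoneOn g (Ico 0 1)) {ρ₀ ρ₁ : ℝ} (h0 : ρ₀ ∈ Ico (0 : ℝ) 1)
    (h1 : ρ₁ ∈ Ico (0 : ℝ) 1) :
    potential g ρ₀ + g ρ₀ * (Real.artanh ρ₁ - Real.artanh ρ₀) ≤ potential g ρ₁ := by
  rcases lt_trichotomy ρ₀ ρ₁ with h | h | h
  · obtain ⟨ξ, hξ, e⟩ := exists_potential_sub_eq hg h0.1 h h1.2
    have hr := Real.artanh_lt_artanh (by linarith [h0.1]) h1.2 h
    have := hmono h0 ⟨h0.1.trans hξ.1.le, hξ.2.trans h1.2⟩ hξ.1.le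
    nlinarith
  · simp [h]
  · obtain ⟨ξ, hξ, e⟩ := exists_potential_sub_eq hg h1.1 h h0.2
    have hr := Real.artanh_lt_artanh (by linarith [h1.1]) h0.2 h
    have := hmono ⟨h1.1.trans hξ.1.le, hξ.2.trans h0.2⟩ h0 hξ.2.le
    nlinarith

theorem potential_add_lt {g : ℝ → ℝ} (hg : ContinuousOn g (Ico 0 1))
    (hmono : StrictMonoOn g (Ico 0 1)) {ρ₀ ρ₁ : ℝ} (h0 : ρ₀ ∈ Ico (0 : ℝ) 1)
    (h1 : ρ₁ ∈ Ico (0 : ℝ) 1) (hne : ρ₀ ≠ ρ₁) :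
    potential g ρ₀ + g ρ₀ * (Real.artanh ρ₁ - Real.artanh ρ₀) < potential g ρ₁ := by
  rcases lt_or_gt_of_ne hne with h | h
  · obtain ⟨ξ, hξ, e⟩ := exists_potential_sub_eq hg h0.1 h h1.2
    have hr := Real.artanh_lt_artanh (by linarith [h0.1]) h1.2 h
    have := hmono h0 ⟨h0.1.trans hξ.1.le, hξ.2.trans h1.2⟩ hξ.1
    nlinarith
  · obtain ⟨ξ, hξ, e⟩ := exists_potential_sub_eq hg h1.1 h h0.2
    have hr := Real.artanh_lt_artanh (by linarith [h1.1]) h0.2 h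
    have := hmono ⟨h1.1.trans hξ.1.le, hξ.2.trans h0.2⟩ h0 hξ.2
    nlinarith

/-- Strict support inequality for the potential along the hyperbolic geodesic through `0` in the
direction of `a`. If `g` is only weakly increasing, strictness needs `z` to lie off the line `ℝa`:
along that line the potential may be affine. -/
theorem potential_add_inner_lt {n : ℕ} {g : ℝ → ℝ} (hg : ContinuousOn g (Ico 0 1))
    (hmono : MonotoneOn g (Ico 0 1)) (hpos : ∀ r ∈ Ioo (0 : ℝ) 1, 0 < g r) {a z : Pt n}
    (ha : a ∈ Metric.ball (0 : Pt n) 1) (ha0 : a ≠ 0) (hz : z ∈ Metric.ball (0 : Pt n) 1)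
    (hs : z ∉ Submodule.span ℝ {a} ∨ StrictMonoOn g (Ico 0 1)) :
    potential g ‖z‖ + Real.artanh ‖a‖ / ‖a‖ * inner ℝ (radialField g z) a <
      potential g ‖mobius a z‖ := by
  have hna : 0 < ‖a‖ := norm_pos_iff.2 ha0
  have hI : ∀ {w : Pt n}, w ∈ Metric.ball (0 : Pt n) 1 → ‖w‖ ∈ Ico (0 : ℝ) 1 := fun hw =>
    ⟨norm_nonneg _, (norm_mem_Ioo hw).2⟩
  have hm := mobius_mem_ball ha hz
  have hsa : 0 < Real.artanh ‖a‖ := Real.artanh_pos ⟨hna, (hI ha).2⟩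
  by_cases hz0 : z = 0
  · have h1 : mobius a (0 : Pt n) = a := by simp [mobius]
    subst hz0
    obtain ⟨ξ, hξ, e⟩ := exists_potential_sub_eq hg le_rfl hna (hI ha).2
    have := mul_pos (hpos ξ ⟨hξ.1, hξ.2.trans (hI ha).2⟩) hsa
    simp only [potential_zero, Real.artanh_zero, sub_zero] at e
    simpa [h1, radialField, potential_zero, e] using this
  have hnz : 0 < ‖z‖ := norm_pos_iff.2 hz0
  have hgz : 0 < g ‖z‖ := hpos _ ⟨hnz, (hI hz).2⟩
  -- `c` is the cosine of the angle between `a` and `z`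
  set c : ℝ := inner ℝ a z / (‖a‖ * ‖z‖) with hcdef
  have hc : inner ℝ a z = ‖a‖ * ‖z‖ * c := by
    rw [hcdef]
    field_simp
  have hc1 : |c| ≤ 1 := abs_real_inner_div_norm_mul_norm_le_one a z
  have hv : Real.artanh ‖a‖ / ‖a‖ * inner ℝ (radialField g z) a =
      g ‖z‖ * (c * Real.artanh ‖a‖) := by
    rw [radialField, if_neg hz0, inner_smul_left, inner_smul_left, real_inner_comm, hc]
    simp only [conj_trivial]
    field_simp
  rw [hv]
  have hlaw := cosh_two_mul_artanh_norm_mobius ha hz hc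
  have hr1 : 0 ≤ Real.artanh ‖mobius a z‖ := Real.artanh_nonneg (norm_nonneg _)
  have hr0 : 0 < Real.artanh ‖z‖ := Real.artanh_pos ⟨hnz, (hI hz).2⟩
  have hle := cosh_add_mul_le hc1 (2 * Real.artanh ‖z‖) (2 * Real.artanh ‖a‖)
  rw [← hlaw, Real.cosh_le_cosh, abs_of_nonneg (a := 2 * Real.artanh ‖mobius a z‖)
    (by linarith)] at hle
  have hle1 := (abs_le.1 hle).2
  have hle2 := (abs_le.1 hle).1
  have hle' : c * Real.artanh ‖a‖ ≤ Real.artanh ‖mobius a z‖ - Real.artanh ‖z‖ := by linarith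
  have hG := potential_add_le hg hmono (hI hz) (hI hm)
  by_cases hc2 : |c| < 1
  · have hlt := cosh_add_mul_lt hc2 (2 * Real.artanh ‖z‖) (s := 2 * Real.artanh ‖a‖)
      (by linarith)
    rw [← hlaw, Real.cosh_lt_cosh, abs_of_nonneg (a := 2 * Real.artanh ‖mobius a z‖)
      (by linarith)] at hlt
    have hlt1 := (abs_lt.1 hlt).2
    have hlt' : c * Real.artanh ‖a‖ < Real.artanh ‖mobius a z‖ - Real.artanh ‖z‖ := by linarith
    have := mul_lt_mul_of_pos_left hlt' hgz
    linarith
  have hc3 : |c| = 1 := le_antisymm hc1 (not_lt.1 hc2)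
  have hst : StrictMonoOn g (Ico 0 1) := by
    refine hs.resolve_left fun h => h ?_
    obtain ⟨_, r, _, hr⟩ := (abs_real_inner_div_norm_mul_norm_eq_one_iff a z).1 hc3
    exact Submodule.mem_span_singleton.2 ⟨r, hr.symm⟩
  by_cases he : ‖z‖ = ‖mobius a z‖
  · -- the two points are reflections of each other, and `z` is moved towards the origin
    rw [← he] at hle1 hle2 ⊢
    have hc0 : c < 0 := by
      by_contra! h
      rw [abs_of_nonneg h] at hc3
      rw [hc3] at hle1
      linarith
    have := mul_pos_of_neg_of_neg (mul_neg_of_neg_of_pos hc0 hsa) (neg_neg_of_pos hgz)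
    linarith
  · have := potential_add_lt hg hst (hI hz) (hI hm) he
    have := mul_le_mul_of_nonneg_left hle' hgz.le
    linarith

/-! ### The energy of a mass distribution in the ball -/

/-- The energy `E(x) = ∫ G(|T_x(Z(a))|) dν(a)` of the distribution of `Z` under `ν`. -/
noncomputable def energy {n : ℕ} {α : Type*} [MeasurableSpace α] (g : ℝ → ℝ) (ν : Measure α)
    (Z : α → Pt n) (x : Pt n) : ℝ :=
  ∫ a, potential g ‖mobius x (Z a)‖ ∂ν

theorem mem_ball_of_norm_le {n : ℕ} {R : ℝ} (hR : R < 1) {z : Pt n} (hz : ‖z‖ ≤ R) :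
    z ∈ Metric.ball (0 : Pt n) 1 := by
  rw [mem_ball_zero_iff]
  linarith

theorem continuousOn_potential_norm {n : ℕ} {g : ℝ → ℝ} (hg : ContinuousOn g (Ico 0 1)) :
    ContinuousOn (fun w : Pt n => potential g ‖w‖) (Metric.ball (0 : Pt n) 1) :=
  (continuousOn_potential hg).comp continuous_norm.continuousOn fun _ hw => norm_mem_Ioo hw

theorem continuousAt_potential_norm_mobius {n : ℕ} {g : ℝ → ℝ} (hg : ContinuousOn g (Ico 0 1))
    {x z : Pt n} (hx : x ∈ Metric.ball (0 : Pt n) 1) (hz : z ∈ Metric.ball (0 : Pt n) 1) :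
    ContinuousAt (fun w : Pt n × Pt n => potential g ‖mobius w.1 w.2‖) (x, z) := by
  have h : ContinuousOn (fun w : Pt n × Pt n => potential g ‖mobius w.1 w.2‖)
      (Metric.ball (0 : Pt n) 1 ×ˢ Metric.ball (0 : Pt n) 1) :=
    (continuousOn_potential_norm hg).comp continuousOn_mobius
      fun w hw => mobius_mem_ball hw.1 hw.2
  exact h.continuousAt ((Metric.isOpen_ball.prod Metric.isOpen_ball).mem_nhds ⟨hx, hz⟩)

theorem exists_bound_comp_mobius {n : ℕ} {E : Type*} [NormedAddCommGroup E] {h : Pt n → E}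
    (hh : ContinuousOn h (Metric.ball (0 : Pt n) 1)) {r R : ℝ} (hr : r < 1) (hR : R < 1) :
    ∃ C, ∀ x z : Pt n, ‖x‖ ≤ r → ‖z‖ ≤ R → ‖h (mobius x z)‖ ≤ C := by
  have hK : IsCompact (Metric.closedBall (0 : Pt n) r ×ˢ Metric.closedBall (0 : Pt n) R) :=
    (isCompact_closedBall _ _).prod (isCompact_closedBall _ _)
  have hc : ContinuousOn (fun q : Pt n × Pt n => h (mobius q.1 q.2))
      (Metric.closedBall (0 : Pt n) r ×ˢ Metric.closedBall (0 : Pt n) R) := by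
    refine (hh.comp continuousOn_mobius fun q hq => mobius_mem_ball hq.1 hq.2).mono ?_
    exact prod_mono (Metric.closedBall_subset_ball hr) (Metric.closedBall_subset_ball hR)
  obtain ⟨C, hC⟩ := hK.exists_bound_of_continuousOn hc
  exact ⟨C, fun x z hx hz => hC (x, z) ⟨by simpa using hx, by simpa using hz⟩⟩

section

variable {n : ℕ} {α : Type*} [MeasurableSpace α] {ν : Measure α} {g : ℝ → ℝ} {Z : α → Pt n} {R : ℝ}

theorem aestronglyMeasurable_comp_of_ae_mem_ball {E : Type*} [NormedAddCommGroup E] {h : Pt n → E}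
    (hh : ContinuousOn h (Metric.ball (0 : Pt n) 1)) (hZ : AEMeasurable Z ν)
    (hb : ∀ᵐ a ∂ν, Z a ∈ Metric.ball (0 : Pt n) 1) :
    AEStronglyMeasurable (fun a => h (Z a)) ν := by
  have h1 := hh.aestronglyMeasurable (μ := ν.map Z) Metric.isOpen_ball.measurableSet
  have h2 : ∀ᵐ z ∂ν.map Z, z ∈ Metric.ball (0 : Pt n) 1 :=
    (ae_map_iff hZ Metric.isOpen_ball.measurableSet).2 hb
  rw [Measure.restrict_eq_self_of_ae_mem h2] at h1
  exact h1.comp_aemeasurable hZ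

theorem aestronglyMeasurable_comp_mobius {E : Type*} [NormedAddCommGroup E] {h : Pt n → E}
    (hh : ContinuousOn h (Metric.ball (0 : Pt n) 1)) (hZ : AEMeasurable Z ν) (hR : R < 1)
    (hb : ∀ᵐ a ∂ν, ‖Z a‖ ≤ R) {x : Pt n} (hx : x ∈ Metric.ball (0 : Pt n) 1) :
    AEStronglyMeasurable (fun a => h (mobius x (Z a))) ν := by
  refine aestronglyMeasurable_comp_of_ae_mem_ball (h := fun z => h (mobius x z)) ?_ hZ
    (hb.mono fun a ha => mem_ball_of_norm_le hR ha)
  refine hh.comp (fun z hz => ?_) fun z hz => mobius_mem_ball hx hz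
  exact (differentiableAt_mobius_right hx hz).continuousAt.continuousWithinAt

theorem integrable_comp_mobius [IsFiniteMeasure ν] {E : Type*} [NormedAddCommGroup E]
    {h : Pt n → E} (hh : ContinuousOn h (Metric.ball (0 : Pt n) 1)) (hZ : AEMeasurable Z ν)
    (hR : R < 1) (hb : ∀ᵐ a ∂ν, ‖Z a‖ ≤ R) {x : Pt n} (hx : x ∈ Metric.ball (0 : Pt n) 1) :
    Integrable (fun a => h (mobius x (Z a))) ν := by
  obtain ⟨C, hC⟩ := exists_bound_comp_mobius hh (mem_ball_zero_iff.1 hx) hR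
  exact Integrable.of_bound (aestronglyMeasurable_comp_mobius hh hZ hR hb hx) C
    (hb.mono fun a ha => hC x (Z a) le_rfl ha)

theorem integrable_innerSL {F : α → Pt n} (hF : Integrable F ν) :
    Integrable (fun a => innerSL ℝ (F a)) ν := by
  refine hF.norm.mono' ((innerSL ℝ).continuous.comp_aestronglyMeasurable hF.1) ?_
  filter_upwards with a
  rw [innerSL_apply_norm]

/-- The Euclidean gradient of the energy is `(1 - |x|²)⁻¹ ∫ v(T_x(Z)) dν`. -/
theorem hasFDerivAt_energy [IsFiniteMeasure ν] (hg : ContinuousOn g (Ico 0 1)) (hg0 : g 0 = 0)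
    (hZ : AEMeasurable Z ν) (hR : R < 1) (hb : ∀ᵐ a ∂ν, ‖Z a‖ ≤ R) {x : Pt n}
    (hx : x ∈ Metric.ball (0 : Pt n) 1) :
    HasFDerivAt (energy g ν Z)
      (innerSL ℝ ((1 - ‖x‖ ^ 2)⁻¹ • ∫ a, radialField g (mobius x (Z a)) ∂ν)) x := by
  have hv := continuousOn_radialField (n := n) hg hg0
  obtain ⟨r, hxr, hr⟩ := exists_between (mem_ball_zero_iff.1 hx)
  obtain ⟨C, hC⟩ := exists_bound_comp_mobius hv hr hR
  have hI := integrable_comp_mobius hv hZ hR hb hx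
  have hP := continuousOn_potential_norm (n := n) hg
  have hIP := integrable_comp_mobius hP hZ hR hb hx
  have hI' : Integrable (fun a => innerSL ℝ ((1 - ‖x‖ ^ 2)⁻¹ • radialField g (mobius x (Z a)))) ν :=
    integrable_innerSL (hI.smul (1 - ‖x‖ ^ 2)⁻¹)
  have hC0 : ∀ᵐ a ∂ν, 0 ≤ C := hb.mono fun a ha => (norm_nonneg _).trans (hC x (Z a) hxr.le ha)
  have key := hasFDerivAt_integral_of_dominated_of_fderiv_le (μ := ν)
    (F := fun x a => potential g ‖mobius x (Z a)‖)
    (F' := fun x a => innerSL ℝ ((1 - ‖x‖ ^ 2)⁻¹ • radialField g (mobius x (Z a))))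
    (bound := fun _ => (1 - r ^ 2)⁻¹ * C)
    (Metric.isOpen_ball.mem_nhds (mem_ball_zero_iff.2 hxr)) (x₀ := x) ?_
    hIP hI'.1 ?_
    (integrable_const _) ?_
  · refine key.congr_fderiv ?_
    ext v
    rw [ContinuousLinearMap.integral_apply hI']
    simp only [innerSL_apply_apply, inner_smul_left, conj_trivial]
    rw [integral_const_mul, real_inner_comm v, ← integral_inner hI v]
    simp_rw [real_inner_comm v]
  · filter_upwards [Metric.isOpen_ball.mem_nhds hx] with w hw
    exact aestronglyMeasurable_comp_mobius (h := fun w => potential g ‖w‖) hP hZ hR hb hw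
  · filter_upwards [hb, hC0] with a ha hC0 w hw
    rw [mem_ball_zero_iff] at hw
    have h1 : 0 < 1 - r ^ 2 := by nlinarith [norm_nonneg w]
    have h2 : 1 - r ^ 2 ≤ 1 - ‖w‖ ^ 2 := by nlinarith [norm_nonneg w]
    rw [innerSL_apply_norm, norm_smul, norm_inv, Real.norm_of_nonneg (h1.le.trans h2)]
    exact mul_le_mul (inv_anti₀ h1 h2) (hC w (Z a) hw.le ha) (norm_nonneg _) (by positivity)
  · filter_upwards [hb] with a ha w hw
    exact hasFDerivAt_potential_mobius hg hg0
      (mem_ball_of_norm_le hr (mem_ball_zero_iff.1 hw).le) (mem_ball_of_norm_le hR ha)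

theorem exists_le_potential_norm_mobius
    (hG : Tendsto (potential g) (𝓝[<] 1) atTop) (hR : R < 1) (M : ℝ) :
    ∃ r < 1, ∀ x ∈ Metric.ball (0 : Pt n) 1, r ≤ ‖x‖ → ∀ z : Pt n, ‖z‖ ≤ R →
      M ≤ potential g ‖mobius x z‖ := by
  obtain ⟨s, hs, hsM⟩ := (mem_nhdsLT_iff_exists_Ioo_subset' zero_lt_one).1
    (hG.eventually_ge_atTop M)
  have hs1 : max s 0 < 1 := max_lt hs one_pos
  have hs0 : 0 ≤ max s 0 := le_max_right _ _
  set σ := max s 0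
  -- choose `r` so close to `1` that `(1 - r²) / (1 - R)² < 1 - σ²`
  have hc : Tendsto (fun r : ℝ => (1 - r ^ 2) / (1 - R) ^ 2) (𝓝[<] 1) (𝓝 0) := by
    have : Continuous fun r : ℝ => (1 - r ^ 2) / (1 - R) ^ 2 := by fun_prop
    simpa using (this.tendsto 1).mono_left nhdsWithin_le_nhds
  have hσ : 0 < 1 - σ ^ 2 := by nlinarith
  obtain ⟨r, hr, hr'⟩ := ((hc.eventually (gt_mem_nhds hσ)).and
    (Ioo_mem_nhdsLT (zero_lt_one' ℝ))).exists
  refine ⟨r, hr'.2, fun x hx hrx z hz => hsM ⟨?_, ?_⟩⟩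
  · have h1 := one_sub_norm_sq_mobius_le hx (mem_ball_of_norm_le hR hz)
    have hx2 := one_sub_norm_sq_pos hx
    have h2 : (1 - ‖x‖ ^ 2) / (1 - ‖z‖) ^ 2 ≤ (1 - r ^ 2) / (1 - R) ^ 2 := by
      apply div_le_div₀ (by nlinarith [hr'.1, hr'.2]) (by nlinarith [hr'.1])
        (pow_pos (by linarith) 2)
      gcongr
    have h3 : σ ^ 2 < ‖mobius x z‖ ^ 2 := by linarith
    exact (le_max_left s 0).trans_lt (lt_of_pow_lt_pow_left₀ 2 (norm_nonneg _) h3)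
  · exact (norm_mem_Ioo (mobius_mem_ball hx (mem_ball_of_norm_le hR hz))).2

/-- The energy tends to infinity at the unit sphere, uniformly over all distributions carried by
a fixed smaller ball. -/
theorem exists_le_energy [IsFiniteMeasure ν] [NeZero ν] (hg : ContinuousOn g (Ico 0 1))
    (hG : Tendsto (potential g) (𝓝[<] 1) atTop) (hR : R < 1) (M : ℝ) :
    ∃ r < 1, ∀ Z : α → Pt n, AEMeasurable Z ν → (∀ᵐ a ∂ν, ‖Z a‖ ≤ R) →
      ∀ x ∈ Metric.ball (0 : Pt n) 1, r ≤ ‖x‖ → M ≤ energy g ν Z x := by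
  have hν : 0 < ν.real univ := measureReal_univ_pos
  obtain ⟨r, hr, h⟩ := exists_le_potential_norm_mobius (n := n) hG hR (M / ν.real univ)
  refine ⟨r, hr, fun Z hZ hb x hx hrx => ?_⟩
  calc M = ∫ _, M / ν.real univ ∂ν := by
        rw [integral_const, smul_eq_mul]
        field_simp
    _ ≤ energy g ν Z x := integral_mono_ae (integrable_const _)
        (integrable_comp_mobius (h := fun w => potential g ‖w‖)
          (continuousOn_potential_norm hg) hZ hR hb hx)
        (hb.mono fun a ha => h x hx hrx (Z a) ha)

/-- The energy attains its minimum over the ball, and the field average vanishes there. -/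
theorem exists_integral_radialField_eq_zero [IsFiniteMeasure ν] [NeZero ν]
    (hg : ContinuousOn g (Ico 0 1)) (hg0 : g 0 = 0)
    (hG : Tendsto (potential g) (𝓝[<] 1) atTop) (hZ : AEMeasurable Z ν) (hR : R < 1)
    (hb : ∀ᵐ a ∂ν, ‖Z a‖ ≤ R) :
    ∃ x ∈ Metric.ball (0 : Pt n) 1, ∫ a, radialField g (mobius x (Z a)) ∂ν = 0 := by
  have hd := fun {x : Pt n} hx => hasFDerivAt_energy (x := x) hg hg0 hZ hR hb hx
  obtain ⟨r, hr, hcoer⟩ := exists_le_energy (n := n) (ν := ν) hg hG hR (energy g ν Z 0 + 1)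
  specialize hcoer Z hZ hb
  have h0 : (0 : Pt n) ∈ Metric.ball (0 : Pt n) 1 := by simp
  have hr0 : 0 < r := by
    by_contra! h
    have := hcoer 0 h0 (by simpa using h)
    linarith
  obtain ⟨x, hx, hmin⟩ := (isCompact_closedBall (0 : Pt n) r).exists_isMinOn
    ⟨0, by simpa using hr0.le⟩ (f := energy g ν Z)
    fun w hw => (hd (Metric.closedBall_subset_ball hr hw)).continuousAt.continuousWithinAt
  have hxb := Metric.closedBall_subset_ball hr hx
  have hlt : ‖x‖ < r := by
    by_contra! h
    have h1 := hcoer x hxb h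
    have h2 : energy g ν Z x ≤ energy g ν Z 0 := hmin (by simpa using hr0.le)
    linarith
  have hloc : IsLocalMin (energy g ν Z) x :=
    hmin.isLocalMin (mem_of_superset (Metric.isOpen_ball.mem_nhds (mem_ball_zero_iff.2 hlt))
      Metric.ball_subset_closedBall)
  refine ⟨x, hxb, ?_⟩
  have h1 := hloc.hasFDerivAt_eq_zero (hd hxb)
  have h2 := norm_eq_zero.2 h1
  rw [innerSL_apply_norm, norm_eq_zero, smul_eq_zero] at h2
  exact h2.resolve_left (inv_ne_zero (one_sub_norm_sq_pos hxb).ne')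

/-- A zero of the field average is the strict global minimum of the energy. -/
theorem energy_lt_energy [IsFiniteMeasure ν] [NeZero ν] (hg : ContinuousOn g (Ico 0 1))
    (hg0 : g 0 = 0) (hmono : MonotoneOn g (Ico 0 1)) (hpos : ∀ r ∈ Ioo (0 : ℝ) 1, 0 < g r)
    (hZ : AEMeasurable Z ν) (hR : R < 1) (hb : ∀ᵐ a ∂ν, ‖Z a‖ ≤ R)
    {x₀ x₁ : Pt n} (hx₀ : x₀ ∈ Metric.ball (0 : Pt n) 1) (hx₁ : x₁ ∈ Metric.ball (0 : Pt n) 1)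
    (hs : (∀ w : Pt n, ∀ᵐ a ∂ν, mobius x₀ (Z a) ∉ Submodule.span ℝ {w}) ∨
      StrictMonoOn g (Ico 0 1))
    (hzero : ∫ a, radialField g (mobius x₀ (Z a)) ∂ν = 0) (hne : x₁ ≠ x₀) :
    energy g ν Z x₀ < energy g ν Z x₁ := by
  -- in the hyperbolic frame at `x₀`, the point `x₁` is `w`
  set w : Pt n := mobius (-x₀) x₁ with hw
  have hnx₀ : -x₀ ∈ Metric.ball (0 : Pt n) 1 := by simpa using hx₀
  have hwb : w ∈ Metric.ball (0 : Pt n) 1 := mobius_mem_ball hnx₀ hx₁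
  have hx₁w : mobius x₀ w = x₁ := mobius_mobius_neg hx₀ hx₁
  have hw0 : w ≠ 0 := by
    intro h
    apply hne
    rw [← hx₁w, h]
    simp [mobius]
  set κ := Real.artanh ‖w‖ / ‖w‖
  have hv := integrable_comp_mobius (continuousOn_radialField hg hg0) hZ hR hb hx₀
  have hI₀ := integrable_comp_mobius (continuousOn_potential_norm hg) hZ hR hb hx₀
  have hI₁ := integrable_comp_mobius (continuousOn_potential_norm hg) hZ hR hb hx₁
  have hvw : Integrable (fun a => κ * inner ℝ (radialField g (mobius x₀ (Z a))) w) ν :=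
    (hv.inner_const w).const_mul κ
  have hae : ∀ᵐ a ∂ν, mobius x₀ (Z a) ∉ Submodule.span ℝ {w} ∨ StrictMonoOn g (Ico 0 1) := by
    rcases hs with hs | hs
    · exact (hs w).mono fun _ => Or.inl
    · exact ae_of_all _ fun _ => Or.inr hs
  have hlt : ∀ᵐ a ∂ν, 0 < potential g ‖mobius x₁ (Z a)‖ - (potential g ‖mobius x₀ (Z a)‖ +
      κ * inner ℝ (radialField g (mobius x₀ (Z a))) w) := by
    filter_upwards [hae, hb] with a ha hRa
    have hZa := mem_ball_of_norm_le hR hRa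
    have := potential_add_inner_lt hg hmono hpos hwb hw0 (mobius_mem_ball hx₀ hZa) ha
    rw [← norm_mobius_mobius hwb hx₀ hZa, hx₁w] at this
    exact sub_pos.2 this
  have hpos' := (integral_pos_iff_support_of_nonneg_ae (hlt.mono fun _ h => h.le)
    (hI₁.sub (hI₀.add hvw))).2 (by
      rw [pos_iff_ne_zero]
      intro h
      have h1 : ∀ᵐ a ∂ν, False := by
        filter_upwards [hlt, measure_eq_zero_iff_ae_notMem.1 h] with a h1 h2
        exact h2 h1.ne'
      exact NeZero.ne ν (by simpa using h1))
  have hzero' : ∫ a, κ * inner ℝ (radialField g (mobius x₀ (Z a))) w ∂ν = 0 := by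
    rw [integral_const_mul]
    simp_rw [real_inner_comm w]
    rw [integral_inner hv w, hzero, inner_zero_right, mul_zero]
  rw [integral_sub hI₁ (by exact hI₀.add hvw), integral_add hI₀ hvw, hzero', add_zero] at hpos'
  exact sub_pos.1 hpos'

/-- Strict minimum points of the energy over the ball depend continuously on the distribution. -/
theorem continuousWithinAt_of_energy_lt [IsFiniteMeasure ν] [NeZero ν] {Q : Type*}
    [TopologicalSpace Q] [FirstCountableTopology Q] {S : Set Q} {q₀ : Q} (hq₀ : q₀ ∈ S)
    {Z : Q → α → Pt n} {X : Q → Pt n}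
    (hg : ContinuousOn g (Ico 0 1)) (hG : Tendsto (potential g) (𝓝[<] 1) atTop)
    (hZ : ∀ q ∈ S, AEMeasurable (Z q) ν) (hR : R < 1)
    (hb : ∀ᶠ q in 𝓝[S] q₀, ∀ᵐ a ∂ν, ‖Z q a‖ ≤ R)
    (hc : ∀ᵐ a ∂ν, ContinuousWithinAt (fun q => Z q a) S q₀)
    (hX : ∀ q ∈ S, X q ∈ Metric.ball (0 : Pt n) 1)
    (hmin : ∀ q ∈ S, ∀ x ∈ Metric.ball (0 : Pt n) 1, x ≠ X q →
      energy g ν (Z q) (X q) < energy g ν (Z q) x) :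
    ContinuousWithinAt X S q₀ := by
  have hP := continuousOn_potential_norm (n := n) hg
  have hmin' : ∀ q ∈ S, ∀ x ∈ Metric.ball (0 : Pt n) 1,
      energy g ν (Z q) (X q) ≤ energy g ν (Z q) x := by
    intro q hq x hx
    rcases eq_or_ne x (X q) with h | h
    · rw [h]
    · exact (hmin q hq x hx h).le
  have h0 : (0 : Pt n) ∈ Metric.ball (0 : Pt n) 1 := by simp
  have hb₀ : ∀ᵐ a ∂ν, ‖Z q₀ a‖ ≤ R := hb.self_of_nhdsWithin hq₀
  -- the energy is jointly continuous in the point and the parameter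
  have hjoint : ∀ x ∈ Metric.ball (0 : Pt n) 1,
      ContinuousWithinAt (fun u : Pt n × Q => energy g ν (Z u.2) u.1)
        (Metric.ball (0 : Pt n) 1 ×ˢ S) (x, q₀) := by
    intro x hx
    obtain ⟨r, hxr, hr⟩ := exists_between (mem_ball_zero_iff.1 hx)
    obtain ⟨C, hC⟩ := exists_bound_comp_mobius hP hr hR
    have hsnd : Tendsto Prod.snd (𝓝[Metric.ball (0 : Pt n) 1 ×ˢ S] (x, q₀)) (𝓝[S] q₀) := by
      rw [nhdsWithin_prod_eq]
      exact tendsto_snd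
    have hfst : Tendsto Prod.fst (𝓝[Metric.ball (0 : Pt n) 1 ×ˢ S] (x, q₀)) (𝓝 x) :=
      (continuous_fst.tendsto (x, q₀)).mono_left nhdsWithin_le_nhds
    have hF_meas : ∀ᶠ u in 𝓝[Metric.ball (0 : Pt n) 1 ×ˢ S] (x, q₀),
        AEStronglyMeasurable (fun a => potential g ‖mobius u.1 (Z u.2 a)‖) ν := by
      filter_upwards [hsnd.eventually hb, self_mem_nhdsWithin] with u hu hu'
      exact aestronglyMeasurable_comp_mobius (h := fun w => potential g ‖w‖) hP (hZ _ hu'.2) hR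
        hu hu'.1
    have hF_bound : ∀ᶠ u in 𝓝[Metric.ball (0 : Pt n) 1 ×ˢ S] (x, q₀),
        ∀ᵐ a ∂ν, ‖potential g ‖mobius u.1 (Z u.2 a)‖‖ ≤ C := by
      filter_upwards [hsnd.eventually hb, hfst.eventually
        (Metric.isOpen_ball.mem_nhds (mem_ball_zero_iff.2 hxr))] with u hu hu'
      filter_upwards [hu] with a ha
      exact hC _ _ (mem_ball_zero_iff.1 hu').le ha
    have hF_cont : ∀ᵐ a ∂ν, ContinuousWithinAt
        (fun u : Pt n × Q => potential g ‖mobius u.1 (Z u.2 a)‖)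
        (Metric.ball (0 : Pt n) 1 ×ˢ S) (x, q₀) := by
      filter_upwards [hc, hb₀] with a ha hba
      have h1 := continuousAt_potential_norm_mobius hg hx (mem_ball_of_norm_le hR hba)
      have h2 : Tendsto (fun u : Pt n × Q => Z u.2 a)
          (𝓝[Metric.ball (0 : Pt n) 1 ×ˢ S] (x, q₀)) (𝓝 (Z q₀ a)) := ha.tendsto.comp hsnd
      have h3 := h1.tendsto.comp (hfst.prodMk_nhds h2)
      exact h3
    exact continuousWithinAt_of_dominated hF_meas hF_bound (integrable_const C) hF_cont
  -- the minimum points stay in a fixed compact part of the ball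
  obtain ⟨C, hC⟩ := exists_bound_comp_mobius hP zero_lt_one hR
  obtain ⟨r, hr, hcoer⟩ := exists_le_energy (n := n) (ν := ν) hg hG hR (C * ν.real univ + 1)
  have hmem : ∀ᶠ q in 𝓝[S] q₀, X q ∈ Metric.closedBall (0 : Pt n) r := by
    filter_upwards [hb, self_mem_nhdsWithin] with q hq hqS
    by_contra h
    rw [mem_closedBall_zero_iff, not_le] at h
    have h1 := hcoer (Z q) (hZ q hqS) hq (X q) (hX q hqS) h.le
    have h2 := hmin' q hqS 0 h0
    have h3 : ∀ᵐ a ∂ν, ‖potential g ‖mobius 0 (Z q a)‖‖ ≤ C :=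
      hq.mono fun a ha => hC 0 (Z q a) norm_zero.le ha
    have h4 : energy g ν (Z q) 0 ≤ C * ν.real univ :=
      (le_abs_self _).trans (norm_integral_le_of_norm_le_const h3)
    linarith
  -- every cluster point minimizes the energy of the limiting distribution
  have hclus : ∀ y ∈ Metric.closedBall (0 : Pt n) r, MapClusterPt y (𝓝[S] q₀) X → y = X q₀ := by
    intro y hy hcl
    have hyb := Metric.closedBall_subset_ball hr hy
    obtain ⟨U, hU, hXU⟩ := mapClusterPt_iff_ultrafilter.1 hcl
    have hUS : ∀ᶠ q in (U : Filter Q), q ∈ S := hU self_mem_nhdsWithin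
    have hUq : Tendsto (fun q => q) (U : Filter Q) (𝓝 q₀) := hU.trans nhdsWithin_le_nhds
    have u1 : Tendsto (fun q => (X q, q)) (U : Filter Q)
        (𝓝[Metric.ball (0 : Pt n) 1 ×ˢ S] (y, q₀)) :=
      tendsto_nhdsWithin_iff.2 ⟨hXU.prodMk_nhds hUq, hUS.mono fun q hq => ⟨hX q hq, hq⟩⟩
    have u2 : Tendsto (fun q => (X q₀, q)) (U : Filter Q)
        (𝓝[Metric.ball (0 : Pt n) 1 ×ˢ S] (X q₀, q₀)) :=
      tendsto_nhdsWithin_iff.2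
        ⟨tendsto_const_nhds.prodMk_nhds hUq, hUS.mono fun q hq => ⟨hX q₀ hq₀, hq⟩⟩
    have t1 := (hjoint y hyb).tendsto.comp u1
    have t2 := (hjoint _ (hX q₀ hq₀)).tendsto.comp u2
    have hle := le_of_tendsto_of_tendsto t1 t2 (hUS.mono fun q hq => hmin' q hq _ (hX q₀ hq₀))
    by_contra hne
    exact (hmin q₀ hq₀ y hyb hne).not_ge hle
  have hlim : Tendsto X (𝓝[S] q₀) (𝓝 (X q₀)) :=
    (isCompact_closedBall (0 : Pt n) r).tendsto_nhds_of_unique_mapClusterPt hmem hclus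
  exact hlim

end

/-! ### The fold map -/

/-- The fold onto the halfball `H_p`, written as `w - 2 max(0, w·p) p`. In contrast to the
definition by cases, this formula shows the continuity in `(p, w)`. -/
noncomputable def foldAtZero {n : ℕ} (p w : Pt n) : Pt n :=
  w - (2 * max 0 (inner ℝ w p)) • p

theorem continuous_foldAtZero {n : ℕ} :
    Continuous (fun u : Pt n × Pt n => foldAtZero u.1 u.2) := by
  unfold foldAtZero
  fun_prop

theorem foldAtZero_of_nonpos {n : ℕ} {p w : Pt n} (h : inner ℝ w p ≤ 0) : foldAtZero p w = w := by
  simp [foldAtZero, max_eq_left h]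

theorem foldAtZero_of_nonneg {n : ℕ} {p w : Pt n} (h : 0 ≤ inner ℝ w p) :
    foldAtZero p w = reflectAtZero p w := by
  simp [foldAtZero, reflectAtZero, max_eq_right h]

theorem norm_reflectAtZero {n : ℕ} {p : Pt n} (hp : ‖p‖ = 1) (w : Pt n) :
    ‖reflectAtZero p w‖ = ‖w‖ := by
  refine (sq_eq_sq₀ (norm_nonneg _) (norm_nonneg _)).1 ?_
  rw [reflectAtZero, norm_sub_sq_real, inner_smul_right, norm_smul, hp, mul_pow,
    Real.norm_eq_abs, sq_abs]
  ring

theorem reflectAtZero_reflectAtZero {n : ℕ} {p : Pt n} (hp : ‖p‖ = 1) (w : Pt n) :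
    reflectAtZero p (reflectAtZero p w) = w := by
  simp only [reflectAtZero, inner_sub_left, inner_smul_left, conj_trivial,
    real_inner_self_eq_norm_sq, hp]
  module

theorem norm_foldAtZero {n : ℕ} {p : Pt n} (hp : ‖p‖ = 1) (w : Pt n) :
    ‖foldAtZero p w‖ = ‖w‖ := by
  rcases le_total (inner ℝ w p) 0 with h | h
  · rw [foldAtZero_of_nonpos h]
  · rw [foldAtZero_of_nonneg h, norm_reflectAtZero hp]

theorem norm_smul_of_norm_eq_one {n : ℕ} {p : Pt n} (hp : ‖p‖ = 1) (t : ℝ) : ‖t • p‖ = |t| := by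
  rw [norm_smul, hp, mul_one, Real.norm_eq_abs]

theorem smul_mem_ball {n : ℕ} {p : Pt n} (hp : ‖p‖ = 1) {t : ℝ} (ht : |t| < 1) :
    t • p ∈ Metric.ball (0 : Pt n) 1 := by
  rwa [mem_ball_zero_iff, norm_smul_of_norm_eq_one hp]

theorem neg_mem_ball {n : ℕ} {x : Pt n} (hx : x ∈ Metric.ball (0 : Pt n) 1) :
    -x ∈ Metric.ball (0 : Pt n) 1 := by
  simpa using hx

theorem mem_halfBall_iff {n : ℕ} {p y : Pt n} (hp : ‖p‖ = 1) {t : ℝ} (ht : |t| < 1)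
    (hy : y ∈ Metric.ball (0 : Pt n) 1) :
    y ∈ halfBall p t ↔ inner ℝ (mobius (-(t • p)) y) p ≤ 0 := by
  have hb := smul_mem_ball hp ht
  constructor
  · rintro ⟨w, ⟨hw, hwp⟩, rfl⟩
    rwa [mobius_neg_mobius hb hw]
  · intro h
    exact ⟨_, ⟨mobius_mem_ball (neg_mem_ball hb) hy, h⟩, mobius_mobius_neg hb hy⟩

theorem fold_eq {n : ℕ} {p y : Pt n} (hp : ‖p‖ = 1) {t : ℝ} (ht : |t| < 1)
    (hy : y ∈ Metric.ball (0 : Pt n) 1) :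
    fold p t y = mobius (t • p) (foldAtZero p (mobius (-(t • p)) y)) := by
  unfold fold
  split_ifs with h
  · rw [mem_halfBall_iff hp ht hy] at h
    rw [foldAtZero_of_nonpos h, mobius_mobius_neg (smul_mem_ball hp ht) hy]
  · rw [mem_halfBall_iff hp ht hy, not_le] at h
    rw [foldAtZero_of_nonneg h.le, hypReflect]

theorem foldAtZero_mobius_mem_ball {n : ℕ} {p y : Pt n} (hp : ‖p‖ = 1) {t : ℝ} (ht : |t| < 1)
    (hy : y ∈ Metric.ball (0 : Pt n) 1) :
    foldAtZero p (mobius (-(t • p)) y) ∈ Metric.ball (0 : Pt n) 1 := by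
  have := mobius_mem_ball (neg_mem_ball (smul_mem_ball hp ht)) hy
  rw [mem_ball_zero_iff] at this ⊢
  rwa [norm_foldAtZero hp]

theorem exists_norm_fold_le {n : ℕ} {T R : ℝ} (hT0 : 0 ≤ T) (hT : T < 1) (hR0 : 0 ≤ R)
    (hR : R < 1) :
    ∃ R' < 1, ∀ (p : Pt n) (t : ℝ) (y : Pt n), ‖p‖ = 1 → |t| ≤ T → ‖y‖ ≤ R →
      ‖fold p t y‖ ≤ R' := by
  have hT2 : 0 < 1 - T ^ 2 := by nlinarith
  have hR2 : 0 < 1 - R ^ 2 := by nlinarith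
  set δ := (1 - T ^ 2) * ((1 - T ^ 2) * (1 - R ^ 2) / 4) / 4 with hδ
  have hδ0 : 0 < δ := by positivity
  refine ⟨√(1 - δ), ?_, fun p t y hp ht hy => ?_⟩
  · rw [Real.sqrt_lt' one_pos]
    linarith
  have ht1 : |t| < 1 := ht.trans_lt hT
  have hyb := mem_ball_of_norm_le hR hy
  have hb := smul_mem_ball hp ht1
  have h1 := one_sub_norm_sq_mobius_ge (neg_mem_ball hb) hyb
  have h2 := one_sub_norm_sq_mobius_ge hb (foldAtZero_mobius_mem_ball hp ht1 hyb)
  rw [norm_foldAtZero hp, norm_smul_of_norm_eq_one hp, ← fold_eq hp ht1 hyb] at h2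
  rw [norm_neg, norm_smul_of_norm_eq_one hp] at h1
  have ht2 : 1 - T ^ 2 ≤ 1 - |t| ^ 2 := by gcongr
  have hy2 : 1 - R ^ 2 ≤ 1 - ‖y‖ ^ 2 := by gcongr
  have h3 : (1 - T ^ 2) * (1 - R ^ 2) / 4 ≤ 1 - ‖mobius (-(t • p)) y‖ ^ 2 :=
    le_trans (by gcongr; linarith) h1
  have h4 : δ ≤ 1 - ‖fold p t y‖ ^ 2 := le_trans (by rw [hδ]; gcongr; linarith) h2
  exact Real.le_sqrt_of_sq_le (by linarith)

theorem continuousOn_fold {n : ℕ} :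
    ContinuousOn (fun u : (Pt n × ℝ) × Pt n => fold u.1.1 u.1.2 u.2)
      ((Metric.sphere (0 : Pt n) 1 ×ˢ Ioo (-1 : ℝ) 1) ×ˢ Metric.ball (0 : Pt n) 1) := by
  have hs : ∀ u ∈ (Metric.sphere (0 : Pt n) 1 ×ˢ Ioo (-1 : ℝ) 1) ×ˢ Metric.ball (0 : Pt n) 1,
      ‖u.1.1‖ = 1 ∧ |u.1.2| < 1 ∧ u.2 ∈ Metric.ball (0 : Pt n) 1 := fun u hu =>
    ⟨mem_sphere_zero_iff_norm.1 hu.1.1, abs_lt.2 hu.1.2, hu.2⟩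
  have h1 : ContinuousOn (fun u : (Pt n × ℝ) × Pt n => mobius (-(u.1.2 • u.1.1)) u.2)
      ((Metric.sphere (0 : Pt n) 1 ×ˢ Ioo (-1 : ℝ) 1) ×ˢ Metric.ball (0 : Pt n) 1) :=
    continuousOn_mobius.comp
      (f := fun u : (Pt n × ℝ) × Pt n => (-(u.1.2 • u.1.1), u.2)) (by fun_prop)
      fun u hu => ⟨neg_mem_ball (smul_mem_ball (hs u hu).1 (hs u hu).2.1), hu.2⟩
  have h2 : ContinuousOn
      (fun u : (Pt n × ℝ) × Pt n => foldAtZero u.1.1 (mobius (-(u.1.2 • u.1.1)) u.2))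
      ((Metric.sphere (0 : Pt n) 1 ×ˢ Ioo (-1 : ℝ) 1) ×ˢ Metric.ball (0 : Pt n) 1) :=
    continuous_foldAtZero.comp_continuousOn
      (f := fun u : (Pt n × ℝ) × Pt n => (u.1.1, mobius (-(u.1.2 • u.1.1)) u.2))
      (ContinuousOn.prodMk (by fun_prop) h1)
  have h3 : ContinuousOn (fun u : (Pt n × ℝ) × Pt n =>
      mobius (u.1.2 • u.1.1) (foldAtZero u.1.1 (mobius (-(u.1.2 • u.1.1)) u.2)))
      ((Metric.sphere (0 : Pt n) 1 ×ˢ Ioo (-1 : ℝ) 1) ×ˢ Metric.ball (0 : Pt n) 1) :=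
    continuousOn_mobius.comp
      (f := fun u : (Pt n × ℝ) × Pt n =>
        (u.1.2 • u.1.1, foldAtZero u.1.1 (mobius (-(u.1.2 • u.1.1)) u.2)))
      (ContinuousOn.prodMk (by fun_prop) h2)
      fun u hu => ⟨smul_mem_ball (hs u hu).1 (hs u hu).2.1,
        foldAtZero_mobius_mem_ball (hs u hu).1 (hs u hu).2.1 hu.2⟩
  exact h3.congr fun u hu => fold_eq (hs u hu).1 (hs u hu).2.1 hu.2

/-! ### Null sets -/

theorem volume_preimage_mobius_eq_zero {n : ℕ} {x : Pt n} (hx : x ∈ Metric.ball (0 : Pt n) 1)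
    {N : Set (Pt n)} (hN : volume N = 0) :
    volume {y | y ∈ Metric.ball (0 : Pt n) 1 ∧ mobius x y ∈ N} = 0 := by
  refine measure_mono_null (t := mobius (-x) '' (N ∩ Metric.ball (0 : Pt n) 1)) ?_ ?_
  · rintro y ⟨hy, hyN⟩
    exact ⟨mobius x y, ⟨hyN, mobius_mem_ball hx hy⟩, mobius_neg_mobius hx hy⟩
  · refine addHaar_image_eq_zero_of_differentiableOn_of_addHaar_eq_zero _ (fun y hy => ?_)
      (measure_mono_null inter_subset_left hN)
    exact (differentiableAt_mobius_right (neg_mem_ball hx) hy.2).differentiableWithinAt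

theorem volume_preimage_reflectAtZero_eq_zero {n : ℕ} {p : Pt n} (hp : ‖p‖ = 1)
    {N : Set (Pt n)} (hN : volume N = 0) : volume {y | reflectAtZero p y ∈ N} = 0 := by
  refine measure_mono_null (t := reflectAtZero p '' N) ?_ ?_
  · intro y hy
    exact ⟨_, hy, reflectAtZero_reflectAtZero hp y⟩
  · refine addHaar_image_eq_zero_of_differentiableOn_of_addHaar_eq_zero _ (fun y _ => ?_) hN
    have h : DifferentiableAt ℝ (fun y : Pt n => (inner ℝ y p : ℝ)) y :=
      differentiableAt_id.inner ℝ (differentiableAt_const p)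
    have : DifferentiableAt ℝ (fun y : Pt n => y - (2 * inner ℝ y p) • p) y := by fun_prop
    exact this.differentiableWithinAt

/-- In dimension at least two, `T_x ∘ F` maps almost no point to a given line through `0`. -/
theorem ae_mobius_fold_notMem_span {n : ℕ} (hn : 2 ≤ n) {p : Pt n} (hp : ‖p‖ = 1) {t : ℝ}
    (ht : |t| < 1) {x : Pt n} (hx : x ∈ Metric.ball (0 : Pt n) 1) (w : Pt n) :
    ∀ᵐ y : Pt n, y ∈ Metric.ball (0 : Pt n) 1 → mobius x (fold p t y) ∉ Submodule.span ℝ {w} := by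
  have hL : volume (Submodule.span ℝ {w} : Set (Pt n)) = 0 := by
    refine Measure.addHaar_submodule _ _ fun h => ?_
    have h1 := finrank_span_le_card (R := ℝ) ({w} : Set (Pt n))
    rw [h, finrank_top, finrank_euclideanSpace_fin] at h1
    simp only [toFinset_singleton, Finset.card_singleton] at h1
    omega
  have hb := smul_mem_ball hp ht
  have h0 := volume_preimage_mobius_eq_zero hx hL
  have h1 := volume_preimage_mobius_eq_zero hb h0
  have h2 := volume_preimage_reflectAtZero_eq_zero hp h1
  have h3 := volume_preimage_mobius_eq_zero (neg_mem_ball hb) h2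
  filter_upwards [measure_eq_zero_iff_ae_notMem.1 h0, measure_eq_zero_iff_ae_notMem.1 h3]
    with y hy0 hy3 hy hmem
  have hz := mobius_mem_ball (neg_mem_ball hb) hy
  rw [fold_eq hp ht hy] at hmem
  rcases le_total (inner ℝ (mobius (-(t • p)) y) p) 0 with h | h
  · rw [foldAtZero_of_nonpos h, mobius_mobius_neg hb hy] at hmem
    exact hy0 ⟨hy, hmem⟩
  · rw [foldAtZero_of_nonneg h] at hmem
    have hr : reflectAtZero p (mobius (-(t • p)) y) ∈ Metric.ball (0 : Pt n) 1 := by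
      rw [mem_ball_zero_iff, norm_reflectAtZero hp]
      exact mem_ball_zero_iff.1 hz
    exact hy3 ⟨hy, hr, mobius_mem_ball hb hr, hmem⟩

/-! ### The folded mass distribution -/

/-- The measure on `Ω` with density `f(y) (1 - |y|²)⁻ⁿ`. -/
noncomputable def hypMeasure {n : ℕ} (Ω : Set (Pt n)) (f : Pt n → ℝ) : Measure (Pt n) :=
  (volume.restrict Ω).withDensity fun y => ENNReal.ofReal (f y * (1 - ‖y‖ ^ 2) ^ (-(n : ℤ)))

section

variable {n : ℕ} {Ω : Set (Pt n)} {f : Pt n → ℝ}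

theorem ae_weight_nonneg (hΩ : MeasurableSet Ω) (hΩb : Ω ⊆ Metric.ball (0 : Pt n) 1)
    (hf : ∀ y ∈ Ω, 0 ≤ f y) :
    ∀ᵐ y ∂volume.restrict Ω, 0 ≤ f y * (1 - ‖y‖ ^ 2) ^ (-(n : ℤ)) := by
  filter_upwards [ae_restrict_mem hΩ] with y hy
  exact mul_nonneg (hf y hy) (zpow_nonneg (one_sub_norm_sq_pos (hΩb hy)).le _)

theorem isFiniteMeasure_hypMeasure
    (hfInt : IntegrableOn (fun y => f y * (1 - ‖y‖ ^ 2) ^ (-(n : ℤ))) Ω volume) :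
    IsFiniteMeasure (hypMeasure Ω f) :=
  isFiniteMeasure_withDensity_ofReal hfInt.2

theorem hypMeasure_neZero (hΩ : MeasurableSet Ω) (hΩb : Ω ⊆ Metric.ball (0 : Pt n) 1)
    (hf : ∀ y ∈ Ω, 0 ≤ f y)
    (hfInt : IntegrableOn (fun y => f y * (1 - ‖y‖ ^ 2) ^ (-(n : ℤ))) Ω volume)
    (hfPos : 0 < ∫ y in Ω, f y * (1 - ‖y‖ ^ 2) ^ (-(n : ℤ))) :
    NeZero (hypMeasure Ω f) := by
  refine ⟨fun h => ?_⟩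
  have h1 : hypMeasure Ω f univ = 0 := by simp [h]
  rw [hypMeasure, withDensity_apply _ MeasurableSet.univ, Measure.restrict_univ,
    ← ofReal_integral_eq_lintegral_ofReal hfInt (ae_weight_nonneg hΩ hΩb hf),
    ENNReal.ofReal_eq_zero] at h1
  linarith

theorem hypMeasure_absolutelyContinuous : hypMeasure Ω f ≪ volume :=
  (withDensity_absolutelyContinuous _ _).trans Measure.restrict_le_self.absolutelyContinuous

theorem ae_mem_hypMeasure (hΩ : MeasurableSet Ω) : ∀ᵐ y ∂hypMeasure Ω f, y ∈ Ω :=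
  (withDensity_absolutelyContinuous _ _).ae_le (ae_restrict_mem hΩ)

theorem foldIntegrand_ae_eq (hΩ : MeasurableSet Ω) (hΩb : Ω ⊆ Metric.ball (0 : Pt n) 1)
    (hf : ∀ y ∈ Ω, 0 ≤ f y) (g : ℝ → ℝ) (p : Pt n) (t : ℝ) (x : Pt n) :
    foldIntegrand g f p t x =ᵐ[volume.restrict Ω] fun y =>
      (ENNReal.ofReal (f y * (1 - ‖y‖ ^ 2) ^ (-(n : ℤ)))).toReal •
        radialField g (mobius x (fold p t y)) := by
  filter_upwards [ae_weight_nonneg hΩ hΩb hf] with y hy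
  rw [ENNReal.toReal_ofReal hy]
  rfl

theorem integral_foldIntegrand (hΩ : MeasurableSet Ω) (hΩb : Ω ⊆ Metric.ball (0 : Pt n) 1)
    (hf : ∀ y ∈ Ω, 0 ≤ f y)
    (hfInt : IntegrableOn (fun y => f y * (1 - ‖y‖ ^ 2) ^ (-(n : ℤ))) Ω volume)
    (g : ℝ → ℝ) (p : Pt n) (t : ℝ) (x : Pt n) :
    ∫ y in Ω, foldIntegrand g f p t x y =
      ∫ y, radialField g (mobius x (fold p t y)) ∂hypMeasure Ω f := by
  rw [hypMeasure, integral_withDensity_eq_integral_toReal_smul₀ hfInt.1.aemeasurable.ennreal_ofReal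
    (ae_of_all _ fun _ => ENNReal.ofReal_lt_top)]
  exact integral_congr_ae (foldIntegrand_ae_eq hΩ hΩb hf g p t x)

theorem integrableOn_foldIntegrand (hΩ : MeasurableSet Ω) (hΩb : Ω ⊆ Metric.ball (0 : Pt n) 1)
    (hf : ∀ y ∈ Ω, 0 ≤ f y)
    (hfInt : IntegrableOn (fun y => f y * (1 - ‖y‖ ^ 2) ^ (-(n : ℤ))) Ω volume)
    {g : ℝ → ℝ} {p : Pt n} {t : ℝ} {x : Pt n}
    (h : Integrable (fun y => radialField g (mobius x (fold p t y))) (hypMeasure Ω f)) :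
    IntegrableOn (foldIntegrand g f p t x) Ω volume := by
  rw [hypMeasure, integrable_withDensity_iff_integrable_smul₀'
    hfInt.1.aemeasurable.ennreal_ofReal (ae_of_all _ fun _ => ENNReal.ofReal_lt_top)] at h
  exact h.congr (foldIntegrand_ae_eq hΩ hΩb hf g p t x).symm

theorem aemeasurable_fold (hΩ : MeasurableSet Ω) (hΩb : Ω ⊆ Metric.ball (0 : Pt n) 1)
    {q : Pt n × ℝ} (hq : q ∈ Metric.sphere (0 : Pt n) 1 ×ˢ Ioo (-1 : ℝ) 1) :
    AEMeasurable (fold q.1 q.2) (hypMeasure Ω f) := by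
  have hc : ContinuousOn (fold q.1 q.2) (Metric.ball (0 : Pt n) 1) :=
    continuousOn_fold.comp (f := fun y : Pt n => (q, y)) (by fun_prop) fun y hy => ⟨hq, hy⟩
  exact (aestronglyMeasurable_comp_of_ae_mem_ball hc aemeasurable_id
    ((ae_mem_hypMeasure hΩ).mono fun y hy => hΩb hy)).aemeasurable

end

end HypFold

open HypFold in
theorem mainTheorem6 (n : ℕ) (hn : 1 ≤ n)
    (g : ℝ → ℝ) (hg : ContinuousOn g (Set.Ico 0 1)) (hg0 : g 0 = 0)
    (hgInt : Filter.Tendsto (fun ρ : ℝ => ∫ r in (0 : ℝ)..ρ, g r * (1 - r ^ 2)⁻¹)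
      (nhdsWithin 1 (Set.Iio 1)) Filter.atTop)
    (Ω : Set (HypFold.Pt n)) (hΩ : MeasurableSet Ω)
    (hΩc : closure Ω ⊆ Metric.ball (0 : HypFold.Pt n) 1)
    (f : HypFold.Pt n → ℝ) (hf : ∀ y ∈ Ω, 0 ≤ f y)
    (hfInt : MeasureTheory.IntegrableOn
      (fun y => f y * (1 - ‖y‖ ^ 2) ^ (-(n : ℤ))) Ω MeasureTheory.volume)
    (hfPos : 0 < ∫ y in Ω, f y * (1 - ‖y‖ ^ 2) ^ (-(n : ℤ))) :
    (∀ p ∈ Metric.sphere (0 : HypFold.Pt n) 1, ∀ t ∈ Set.Ioo (-1 : ℝ) 1,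
      (∀ x ∈ Metric.ball (0 : HypFold.Pt n) 1,
        MeasureTheory.IntegrableOn (HypFold.foldIntegrand g f p t x) Ω MeasureTheory.volume) ∧
      ∃ x ∈ Metric.ball (0 : HypFold.Pt n) 1,
        ∫ y in Ω, HypFold.foldIntegrand g f p t x y = 0) ∧
    (MonotoneOn g (Set.Ico 0 1) → (∀ r ∈ Set.Ioo (0 : ℝ) 1, 0 < g r) →
      (2 ≤ n ∨ StrictMonoOn g (Set.Ico 0 1)) →
      ∃ X : HypFold.Pt n × ℝ → HypFold.Pt n,
        ContinuousOn X (Metric.sphere (0 : HypFold.Pt n) 1 ×ˢ Set.Ioo (-1 : ℝ) 1) ∧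
        ∀ p ∈ Metric.sphere (0 : HypFold.Pt n) 1, ∀ t ∈ Set.Ioo (-1 : ℝ) 1,
          X (p, t) ∈ Metric.ball (0 : HypFold.Pt n) 1 ∧
          ∀ x ∈ Metric.ball (0 : HypFold.Pt n) 1,
            (∫ y in Ω, HypFold.foldIntegrand g f p t x y = 0 ↔ x = X (p, t))) := by
  have hG := tendsto_potential hgInt
  have hΩb : Ω ⊆ Metric.ball (0 : Pt n) 1 := subset_closure.trans hΩc
  obtain ⟨R₀, hR₀, hR₀1, hΩR⟩ : ∃ R₀ : ℝ, 0 ≤ R₀ ∧ R₀ < 1 ∧ ∀ y ∈ Ω, ‖y‖ ≤ R₀ := by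
    obtain ⟨r, ⟨hr0, hr1⟩, hr⟩ := exists_pos_lt_subset_ball zero_lt_one isClosed_closure hΩc
    exact ⟨r, hr0.le, hr1, fun y hy => (mem_ball_zero_iff.1 (hr (subset_closure hy))).le⟩
  set ν := hypMeasure Ω f with hν
  have hfin : IsFiniteMeasure ν := isFiniteMeasure_hypMeasure hfInt
  have hne : NeZero ν := hypMeasure_neZero hΩ hΩb hf hfInt hfPos
  have hmemΩ : ∀ᵐ y ∂ν, y ∈ Ω := ae_mem_hypMeasure hΩ
  have hint := integral_foldIntegrand hΩ hΩb hf hfInt g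
  have hmeas : ∀ q ∈ Metric.sphere (0 : Pt n) 1 ×ˢ Set.Ioo (-1 : ℝ) 1,
      AEMeasurable (fold q.1 q.2) ν := fun q hq => aemeasurable_fold hΩ hΩb hq
  -- the folded mass stays in a ball of radius less than one, locally uniformly in `t`
  have hbound : ∀ T : ℝ, 0 ≤ T → T < 1 → ∃ R < 1, ∀ p ∈ Metric.sphere (0 : Pt n) 1,
      ∀ t : ℝ, |t| ≤ T → ∀ᵐ y ∂ν, ‖fold p t y‖ ≤ R := by
    intro T hT0 hT
    obtain ⟨R, hR, h⟩ := exists_norm_fold_le (n := n) hT0 hT hR₀ hR₀1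
    exact ⟨R, hR, fun p hp t ht => hmemΩ.mono fun y hy =>
      h p t y (mem_sphere_zero_iff_norm.1 hp) ht (hΩR y hy)⟩
  have hexists : ∀ p ∈ Metric.sphere (0 : Pt n) 1, ∀ t ∈ Set.Ioo (-1 : ℝ) 1,
      ∃ x ∈ Metric.ball (0 : Pt n) 1, ∫ y in Ω, foldIntegrand g f p t x y = 0 := by
    intro p hp t ht
    obtain ⟨R, hR, h⟩ := hbound |t| (abs_nonneg t) (abs_lt.2 ht)
    obtain ⟨x, hx, h0⟩ := exists_integral_radialField_eq_zero hg hg0 hG (hmeas (p, t) ⟨hp, ht⟩)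
      hR (h p hp t le_rfl)
    exact ⟨x, hx, (hint p t x).trans h0⟩
  refine ⟨fun p hp t ht => ⟨fun x hx => ?_, hexists p hp t ht⟩, fun hmono hpos hstrict => ?_⟩
  · obtain ⟨R, hR, h⟩ := hbound |t| (abs_nonneg t) (abs_lt.2 ht)
    exact integrableOn_foldIntegrand hΩ hΩb hf hfInt (integrable_comp_mobius
      (continuousOn_radialField hg hg0) (hmeas (p, t) ⟨hp, ht⟩) hR (h p hp t le_rfl) hx)
  · have hmin : ∀ q ∈ Metric.sphere (0 : Pt n) 1 ×ˢ Set.Ioo (-1 : ℝ) 1,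
        ∀ x₀ ∈ Metric.ball (0 : Pt n) 1, ∫ y in Ω, foldIntegrand g f q.1 q.2 x₀ y = 0 →
        ∀ x ∈ Metric.ball (0 : Pt n) 1, x ≠ x₀ →
          energy g ν (fold q.1 q.2) x₀ < energy g ν (fold q.1 q.2) x := by
      rintro q hq x₀ hx₀ h0 x hx hxne
      obtain ⟨R, hR, h⟩ := hbound |q.2| (abs_nonneg _) (abs_lt.2 hq.2)
      refine energy_lt_energy hg hg0 hmono hpos (hmeas q hq) hR (h q.1 hq.1 q.2 le_rfl) hx₀ hx
        (hstrict.imp_left fun hn2 w => ?_) ((hint q.1 q.2 x₀).symm.trans h0) hxne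
      filter_upwards [hypMeasure_absolutelyContinuous.ae_le (ae_mobius_fold_notMem_span hn2
        (mem_sphere_zero_iff_norm.1 hq.1) (abs_lt.2 hq.2) hx₀ w), hmemΩ] with y hy hyΩ
      exact hy (hΩb hyΩ)
    have hex : ∀ q : Pt n × ℝ, ∃ x, q ∈ Metric.sphere (0 : Pt n) 1 ×ˢ Set.Ioo (-1 : ℝ) 1 →
        x ∈ Metric.ball (0 : Pt n) 1 ∧ ∫ y in Ω, foldIntegrand g f q.1 q.2 x y = 0 := by
      intro q
      by_cases hq : q ∈ Metric.sphere (0 : Pt n) 1 ×ˢ Set.Ioo (-1 : ℝ) 1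
      · obtain ⟨x, hx, h⟩ := hexists q.1 hq.1 q.2 hq.2
        exact ⟨x, fun _ => ⟨hx, h⟩⟩
      · exact ⟨0, fun h => absurd h hq⟩
    choose X hX using hex
    refine ⟨X, fun q₀ hq₀ => ?_, fun p hp t ht => ⟨(hX (p, t) ⟨hp, ht⟩).1, fun x hx => ?_⟩⟩
    · obtain ⟨T, hT1, hT2⟩ := exists_between (abs_lt.2 hq₀.2)
      obtain ⟨R, hR, h⟩ := hbound T ((abs_nonneg _).trans hT1.le) hT2
      refine continuousWithinAt_of_energy_lt hq₀ hg hG hmeas hR ?_ ?_ (fun q hq => (hX q hq).1)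
        fun q hq => hmin q hq (X q) (hX q hq).1 (hX q hq).2
      · have hT : ∀ᶠ q : Pt n × ℝ in 𝓝 q₀, |q.2| < T :=
          (continuous_snd.abs.tendsto q₀).eventually (gt_mem_nhds hT1)
        filter_upwards [mem_nhdsWithin_of_mem_nhds hT, self_mem_nhdsWithin] with q hqT hqS
        exact h q.1 hqS.1 q.2 (le_of_lt hqT)
      · filter_upwards [hmemΩ] with y hy
        exact continuousOn_fold.comp (f := fun q : Pt n × ℝ => (q, y)) (by fun_prop)
          (fun q hq => ⟨hq, hΩb hy⟩) q₀ hq₀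
    · -- two zeros would each have strictly less energy than the other
      obtain ⟨hXb, hX0⟩ := hX (p, t) ⟨hp, ht⟩
      refine ⟨fun h0 => ?_, fun h => h ▸ hX0⟩
      by_contra hxne
      exact lt_asymm (hmin (p, t) ⟨hp, ht⟩ x hx h0 _ hXb (Ne.symm hxne))
        (hmin (p, t) ⟨hp, ht⟩ _ hXb hX0 x hx hxne)
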